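/- Let $\mathbb F$ be a field with algebraic closure $\overline{\mathbb F}$, and let $V$ be a vector space over $\mathbb F$ of finite positive dimension. A tridiagonal pair on $V$ is an ordered pair $A,A^*$ of diagonalizable linear maps $V\to V$ such that: the eigenspaces of $A$ can be ordered $V_0,\dots,V_d$ with $A^*V_i\subseteq V_{i-1}+V_i+V_{i+1}$ for $0\le i\le d$; the eigenspaces of $A^*$ can be ordered $V_0^*,\dots,V_\delta^*$ with $AV^*_i\subseteq V^*_{i-1}+V^*_i+V^*_{i+1}$ for $0\le i\le \delta$ (where $V_{-1}=V_{d+1}=V^*_{-1}=V^*_{\delta+1}=0$); and no subspace $W$ with $0\ne W\neq V$ satisfies both $AW\subseteq W$ and $A^*W\subseteq W$. Such orderings are called standard. A Leonard system $\Phi=(A;\{E_i\}_{i=0}^d;A^*;\{E_i^*\}_{i=0}^d)$ on $V$ consists of a tridiagonal pair $A,A^*$ and of the projections $E_i$ (resp. $E_i^*$) onto the eigenspaces of $A$ (resp. $A^*$), along the sum of the other eigenspaces, in a standard ordering, where all $E_iV$ and $E_i^*V$ have dimension $1$. Let $\theta_i$ (resp. $\theta_i^*$) be the eigenvalue of $A$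 on $E_iV$ (resp. of $A^*$ on $E^*_iV$). For $0\le i\le d$ let $\zeta_i$ be the eigenvalue of $(A^*-\theta_1^*I)\cdots(A^*-\theta_i^*I)(A-\theta_{i-1}I)\cdots(A-\theta_0I)$ on $E_0^*V$. For $0\le i\le d$ let $U_i=(E_0^*V+\cdots+E_i^*V)\cap(E_iV+\cdots+E_dV)$, and for $1\le i\le d$ let $\varphi_i$ be the eigenvalue of $(A-\theta_{i-1}I)(A^*-\theta_i^*I)$ on $U_i$; let $\phi_1,\dots,\phi_d$ be the scalars obtained in this way from the Leonard system $(A;\{E_{d-i}\}_{i=0}^d;A^*;\{E_i^*\}_{i=0}^d)$ instead of $\Phi$. Let $\beta\in\mathbb F$ be a base of $\Phi$: if $d\ge3$, then $\beta+1$ is the common value of $\frac{\theta_{i-2}-\theta_{i+1}}{\theta_{i-1}-\theta_i}$ and $\frac{\theta^*_{i-2}-\theta^*_{i+1}}{\theta^*_{i-1}-\theta^*_i}$ for $2\le i\le d-1$; if $d\le2$, then $\beta$ is any nonzero scalar. Assume that $\Phi$ has type I, that is, $\beta\ne2$ and $\beta\neq-2$. Let $q,a,b,c,a^*,b^*,c^*\in\overline{\mathbb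 F}$ be such that $q\ne0$, $q^2+q^{-2}=\beta$ and, for $0\le i\le d$, $$\theta_i=a+bq^{2i-d}+cq^{d-2i},\qquad \theta_i^*=a^*+b^*q^{2i-d}+c^*q^{d-2i}.$$ The normalized Drinfel'd polynomial of $\Phi$ is $$\hat P=\sum_{i=0}^d\zeta_i\,\hat p_{i+1}\hat p_{i+2}\cdots\hat p_d,\qquad \hat p_i=(q^i-q^{-i})^2\bigl(bb^*q^{2i-2d}+cc^*q^{2d-2i}-\lambda\bigr),$$ a polynomial in $\lambda$ with coefficients in $\overline{\mathbb F}$. Then there exists $t\in\overline{\mathbb F}$ such that for $1\le i\le d$ $$\varphi_i=(q^i-q^{-i})(q^{d-i+1}-q^{i-d-1})(t-bb^*q^{2i-d-1}-cc^*q^{d+1-2i}),$$ $$\phi_i=(q^i-q^{-i})(q^{d-i+1}-q^{i-d-1})(t-cb^*q^{2i-d-1}-bc^*q^{d+1-2i}).$$ Moreover, for every such $t$ the polynomial $\hat P$ is nonzero and the following hold. (i) If $bb^*cc^*\ne0$, then for every nonzero $\psi\in\overline{\mathbb F}$ with $\psi+bb^*cc^*\psi^{-1}=t$, the roots of $\hat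 P$ in $\overline{\mathbb F}$, counted with multiplicity, are $\psi q^{d+1-2i}+bb^*cc^*\psi^{-1}q^{2i-d-1}$ $(1\le i\le d)$. (ii) If $bb^*cc^*=0$, then the roots of $\hat P$ in $\overline{\mathbb F}$, counted with multiplicity, are $tq^{d+1-2i}$ $(1\le i\le d)$. -/

import Mathlib

open Polynomial

/-- An ordering `W 0, …, W d` (without repetition) of all the eigenspaces of `A`. -/
def IsEigenspaceOrdering {F V : Type*} [Field F] [AddCommGroup V] [Module F V] {d : ℕ}
    (A : Module.End F V) (W : Fin (d + 1) → Submodule F V) : Prop :=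
  Function.Injective W ∧
    Set.range W = {U : Submodule F V | U ≠ ⊥ ∧ ∃ θ : F, U = A.eigenspace θ}

/-- A standard ordering of the eigenspaces of `A` with respect to `B`: an ordering with
`B W i ⊆ W (i - 1) + W i + W (i + 1)`, where `W (-1) = W (d + 1) = 0`. -/
def IsStandardOrdering {F V : Type*} [Field F] [AddCommGroup V] [Module F V] {d : ℕ}
    (A B : Module.End F V) (W : Fin (d + 1) → Submodule F V) : Prop :=
  IsEigenspaceOrdering A W ∧
    ∀ i : Fin (d + 1), (W i).map B ≤
      ⨆ j : Fin (d + 1), ⨆ _ : (j : ℕ) ≤ (i : ℕ) + 1 ∧ (i : ℕ) ≤ (j : ℕ) + 1, W j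

/-- Tridiagonal pairs `A, A*` on `V`. -/
structure IsTridiagonalPair {F V : Type*} [Field F] [AddCommGroup V] [Module F V]
    (A As : Module.End F V) : Prop where
  diagonalizable : ⨆ θ : F, A.eigenspace θ = ⊤
  diagonalizable_dual : ⨆ θ : F, As.eigenspace θ = ⊤
  exists_ordering : ∃ (d : ℕ) (W : Fin (d + 1) → Submodule F V), IsStandardOrdering A As W
  exists_ordering_dual :
    ∃ (δ : ℕ) (W : Fin (δ + 1) → Submodule F V), IsStandardOrdering As A W
  irreducible : ¬ ∃ W : Submodule F V, W.map A ≤ W ∧ W.map As ≤ W ∧ W ≠ ⊥ ∧ W ≠ ⊤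

/-- `E 0, …, E d` is a standard ordering of the primitive idempotents of `A`
(with respect to `B`). -/
def IsStandardIdempotents {F V : Type*} [Field F] [AddCommGroup V] [Module F V] {d : ℕ}
    (A B : Module.End F V) (E : Fin (d + 1) → Module.End F V) : Prop :=
  ∃ W : Fin (d + 1) → Submodule F V, IsStandardOrdering A B W ∧
    ∀ i : Fin (d + 1), (∀ v ∈ W i, E i v = v) ∧ ∀ j, j ≠ i → ∀ v ∈ W j, E i v = 0

/-- Tridiagonal systems `(A; E 0, …, E d; A*; E* 0, …, E* d)` on `V`. -/
structure TridiagonalSystem (F V : Type*) [Field F] [AddCommGroup V] [Module F V]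
    (d : ℕ) where
  A : Module.End F V
  E : Fin (d + 1) → Module.End F V
  As : Module.End F V
  Es : Fin (d + 1) → Module.End F V
  pair : IsTridiagonalPair A As
  standard : IsStandardIdempotents A As E
  standard_dual : IsStandardIdempotents As A Es

/-- The scalar by which `X` acts on the subspace `W` (junk value `0` if `X` does not act on `W`
as a scalar; determined by `X` and `W` if it does and `W ≠ 0`). -/
noncomputable def eigenvalueOn {F V : Type*} [Field F] [AddCommGroup V] [Module F V]
    (X : Module.End F V) (W : Submodule F V) : F :=
  open Classical in
  if h : ∃ c : F, ∀ w ∈ W, X w = c • w then h.choose else 0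

theorem IsStandardIdempotents.rev {F V : Type*} [Field F] [AddCommGroup V] [Module F V] {d : ℕ}
    {A B : Module.End F V} {E : Fin (d + 1) → Module.End F V}
    (h : IsStandardIdempotents A B E) : IsStandardIdempotents A B (fun i => E i.rev) := by
  obtain ⟨W, ⟨⟨hinj, hran⟩, htri⟩, hE⟩ := h
  refine ⟨fun i => W i.rev, ⟨⟨fun i j hij => Fin.rev_injective (hinj hij), ?_⟩, ?_⟩, ?_⟩
  · rw [← hran]
    exact Fin.rev_surjective.range_comp W
  · intro i
    refine (htri i.rev).trans (iSup_le fun j => iSup_le fun hj => ?_)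
    refine le_iSup_of_le j.rev (le_iSup_of_le ?_ (by simp))
    have hi := i.isLt
    have hj' := j.isLt
    simp only [Fin.val_rev] at hj ⊢
    omega
  · intro i
    refine ⟨(hE i.rev).1, fun j hj => (hE i.rev).2 j.rev fun hc => hj (Fin.rev_injective hc)⟩

namespace TridiagonalSystem

variable {F V : Type*} [Field F] [AddCommGroup V] [Module F V] {d : ℕ}

/-- The relative `(A; E d, …, E 0; A*; E* 0, …, E* d)`. -/
def downArrow (Φ : TridiagonalSystem F V d) : TridiagonalSystem F V d where
  A := Φ.A
  E := fun i => Φ.E i.rev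
  As := Φ.As
  Es := Φ.Es
  pair := Φ.pair
  standard := Φ.standard.rev
  standard_dual := Φ.standard_dual

/-- A Leonard system: every `E i V` and every `E* i V` has dimension one, that is, the shape
is `(1, 1, …, 1)`. -/
def IsLeonard (Φ : TridiagonalSystem F V d) : Prop :=
  ∀ i, Module.finrank F (LinearMap.range (Φ.E i)) = 1 ∧
    Module.finrank F (LinearMap.range (Φ.Es i)) = 1

/-- The eigenvalue sequence. -/
noncomputable def theta (Φ : TridiagonalSystem F V d) (i : Fin (d + 1)) : F :=
  eigenvalueOn Φ.A (LinearMap.range (Φ.E i))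

/-- The dual eigenvalue sequence. -/
noncomputable def thetaStar (Φ : TridiagonalSystem F V d) (i : Fin (d + 1)) : F :=
  eigenvalueOn Φ.As (LinearMap.range (Φ.Es i))

/-- `β` is a base of the system: for `d ≥ 3`, `β + 1` is the common value of
`(θ_{i-2} - θ_{i+1}) / (θ_{i-1} - θ_i)` and `(θ*_{i-2} - θ*_{i+1}) / (θ*_{i-1} - θ*_i)` for
`2 ≤ i ≤ d - 1` (below, `i = k + 2`); for `d ≤ 2`, `β` is any nonzero scalar. -/
def IsBase (Φ : TridiagonalSystem F V d) (β : F) : Prop :=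
  (d ≤ 2 → β ≠ 0) ∧
    ∀ (k : ℕ) (hk : k + 3 ≤ d),
      (Φ.theta ⟨k, by omega⟩ - Φ.theta ⟨k + 3, by omega⟩) /
          (Φ.theta ⟨k + 1, by omega⟩ - Φ.theta ⟨k + 2, by omega⟩) = β + 1 ∧
      (Φ.thetaStar ⟨k, by omega⟩ - Φ.thetaStar ⟨k + 3, by omega⟩) /
          (Φ.thetaStar ⟨k + 1, by omega⟩ - Φ.thetaStar ⟨k + 2, by omega⟩) = β + 1

/-- The system has type I with respect to the base `β`. -/
def IsTypeI (Φ : TridiagonalSystem F V d) (β : F) : Prop :=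
  Φ.IsBase β ∧ β ≠ 2 ∧ β ≠ -2

/-- The split sequence: `ζ_i` is the eigenvalue of
`(A* - θ*_1) ⋯ (A* - θ*_i) (A - θ_{i-1}) ⋯ (A - θ_0)` on `U_0 = E*_0 V`. -/
noncomputable def splitSeq (Φ : TridiagonalSystem F V d) (i : Fin (d + 1)) : F :=
  eigenvalueOn
    (aeval Φ.As (∏ h : Fin (d + 1) with 0 < h ∧ h ≤ i, (X - C (Φ.thetaStar h))) *
      aeval Φ.A (∏ h : Fin (d + 1) with h < i, (X - C (Φ.theta h))))
    (LinearMap.range (Φ.Es 0))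

/-- The split decomposition
`U_i = (E*_0 V + ⋯ + E*_i V) ∩ (E_i V + ⋯ + E_d V)`. -/
def splitSpace (Φ : TridiagonalSystem F V d) (i : Fin (d + 1)) : Submodule F V :=
  (⨆ j : Fin (d + 1), ⨆ _ : j ≤ i, LinearMap.range (Φ.Es j)) ⊓
    (⨆ j : Fin (d + 1), ⨆ _ : i ≤ j, LinearMap.range (Φ.E j))

/-- The first split sequence of a Leonard system: `φ_i` is the eigenvalue of
`(A - θ_{i-1}) (A* - θ*_i)` on `U_i`, for `1 ≤ i ≤ d`. The argument `k : Fin d` stands for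
`i = k + 1`. -/
noncomputable def firstSplit (Φ : TridiagonalSystem F V d) (k : Fin d) : F :=
  eigenvalueOn
    ((Φ.A - algebraMap F (Module.End F V) (Φ.theta k.castSucc)) *
      (Φ.As - algebraMap F (Module.End F V) (Φ.thetaStar k.succ)))
    (Φ.splitSpace k.succ)

/-- The second split sequence: the first split sequence of the relative
`(A; E d, …, E 0; A*; E* 0, …, E* d)`. -/
noncomputable def secondSplit (Φ : TridiagonalSystem F V d) (k : Fin d) : F :=
  Φ.downArrow.firstSplit k

/-- The polynomial `p̂_i = (q^i - q^{-i})^2 (b b* q^{2i-2d} + c c* q^{2d-2i} - λ)`. -/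
noncomputable def pHat {K : Type*} [Field K] (d : ℕ) (q b c bs cs : K) (i : ℕ) : K[X] :=
  C ((q ^ (i : ℤ) - q ^ (-(i : ℤ))) ^ 2) *
    (C (b * bs * q ^ (2 * (i : ℤ) - 2 * (d : ℤ)) +
      c * cs * q ^ (2 * (d : ℤ) - 2 * (i : ℤ))) - X)

/-- The normalized Drinfel'd polynomial `P̂ = ∑ ζ_i p̂_{i+1} p̂_{i+2} ⋯ p̂_d` (type I). -/
noncomputable def normalizedDrinfeld (Φ : TridiagonalSystem F V d)
    (q b c bs cs : AlgebraicClosure F) : (AlgebraicClosure F)[X] :=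
  ∑ i : Fin (d + 1), C (algebraMap F (AlgebraicClosure F) (Φ.splitSeq i)) *
    ∏ j ∈ Finset.Icc ((i : ℕ) + 1) d, pHat d q b c bs cs j

/-- The scalars `q, a, b, c, a*, b*, c*` parametrize the eigenvalues and dual eigenvalues:
`q ≠ 0`, `q^2 + q^{-2} = β`, `θ_i = a + b q^{2i-d} + c q^{d-2i}` and
`θ*_i = a* + b* q^{2i-d} + c* q^{d-2i}`. -/
def IsTypeIParam (Φ : TridiagonalSystem F V d) (β : F)
    (q a b c as bs cs : AlgebraicClosure F) : Prop :=
  q ≠ 0 ∧ q ^ (2 : ℤ) + q ^ (-2 : ℤ) = algebraMap F (AlgebraicClosure F) β ∧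
    ∀ i : Fin (d + 1),
      algebraMap F (AlgebraicClosure F) (Φ.theta i) =
        a + b * q ^ (2 * (i : ℤ) - (d : ℤ)) + c * q ^ ((d : ℤ) - 2 * (i : ℤ)) ∧
      algebraMap F (AlgebraicClosure F) (Φ.thetaStar i) =
        as + bs * q ^ (2 * (i : ℤ) - (d : ℤ)) + cs * q ^ ((d : ℤ) - 2 * (i : ℤ))

/-- The scalar `t` parametrizes the two split sequences: with `i = k + 1` running over
`1 ≤ i ≤ d`,
`φ_i = (q^i - q^{-i}) (q^{d-i+1} - q^{i-d-1}) (t - b b* q^{2i-d-1} - c c* q^{d+1-2i})` for the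
first one, and the same with `b`, `c` interchanged for the second one. -/
def IsSplitParam (Φ : TridiagonalSystem F V d)
    (q b c bs cs t : AlgebraicClosure F) : Prop :=
  ∀ (k : Fin d) (i : ℤ), i = (k : ℤ) + 1 →
    algebraMap F (AlgebraicClosure F) (Φ.firstSplit k) =
      (q ^ i - q ^ (-i)) * (q ^ ((d : ℤ) - i + 1) - q ^ (i - (d : ℤ) - 1)) *
        (t - b * bs * q ^ (2 * i - (d : ℤ) - 1) - c * cs * q ^ ((d : ℤ) + 1 - 2 * i)) ∧
    algebraMap F (AlgebraicClosure F) (Φ.secondSplit k) =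
      (q ^ i - q ^ (-i)) * (q ^ ((d : ℤ) - i + 1) - q ^ (i - (d : ℤ) - 1)) *
        (t - c * bs * q ^ (2 * i - (d : ℤ) - 1) - b * cs * q ^ ((d : ℤ) + 1 - 2 * i))

end TridiagonalSystem

/-! Fix u spanning E*_0 V. The vectors (A - θ_{i-1}) ⋯ (A - θ_0) u span the lines U_i, and on them
A* is bidiagonal, with diagonal entries θ*_i and off-diagonal entries φ_i. Hence ζ_i = φ_1 ⋯ φ_i
(`splitSeq_eq`).

Since A* is tridiagonal in an eigenbasis of A, the last coordinate of A*w depends only on the last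
two coordinates of w. Evaluated along the split vectors, this one relation determines all φ_i up to
a single free scalar (`exists_split_formula`), and the type I parametrization turns that scalar into
t (`exists_typeI_split`). Reversing the order of the E_i exchanges b and c and gives the φ-formula
for the second sequence; both sequences share the same t because the difference of their first terms
is known (`firstSplit_sub_secondSplit`).

For the roots, choose ψ, ψ' with sum t and product bb*cc*. The matrix with rows (ψ, bb*) and (cc*,
ψ') is then singular, so ψ = αγ, ψ' = βδ, bb* = αδ, cc* = βγ. With s = q^{2i-d-1}, the factor t -
bb*s - cc*/s of φ_i becomes (α - β/s)(γ - δs), and P̂ becomes a nonzero constant times the left side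
of a q-Chu–Vandermonde identity (`sum_symmQBinom_mul_prod`), whose right side is a product of linear
factors in λ. Zero parameters need no separate treatment: (ii) is the case ψ = t, ψ' = 0. -/

/-! ### Eigenbases and their coordinate functionals -/

/-- Coordinate functionals `e 0, …, e d` (and `e j = 0` for `d < j`) of an eigenbasis of `A`, with
eigenvalues `θ`, in which `B` is tridiagonal. -/
structure EigenCoords {F V : Type*} [Field F] [AddCommGroup V] [Module F V]
    (A B : Module.End F V) (d : ℕ) (θ : ℕ → F) (e : ℕ → V →ₗ[F] F) : Prop where
  ext : ∀ w, (∀ j ≤ d, e j w = 0) → w = 0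
  exists_dual : ∀ i ≤ d, ∃ w, e i w = 1 ∧ ∀ j, j ≠ i → e j w = 0
  zero : ∀ j, d < j → e j = 0
  eig : ∀ j w, e j (A w) = θ j * e j w
  tri : ∀ i, ∃ x y z : F, ∀ w, e i (B w) = x * e (i - 1) w + y * e i w + z * e (i + 1) w
  inj : ∀ i j, i ≤ d → j ≤ d → θ i = θ j → i = j

theorem eigenvalueOn_eq {F V : Type*} [Field F] [AddCommGroup V] [Module F V]
    {X : Module.End F V} {W : Submodule F V} {c : F} (hc : ∀ w ∈ W, X w = c • w)
    {w : V} (hw : w ∈ W) (hw0 : w ≠ 0) : eigenvalueOn X W = c := by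
  have h : ∃ c : F, ∀ w ∈ W, X w = c • w := ⟨c, hc⟩
  rw [eigenvalueOn, dif_pos h]
  exact smul_left_injective F hw0 ((h.choose_spec w hw).symm.trans (hc w hw))

theorem Module.Basis.mem_iSup_span_iff {F V ι : Type*} [Field F] [AddCommGroup V] [Module F V]
    [Fintype ι] (v : Module.Basis ι F V) (p : ι → Prop) (w : V) :
    (w ∈ ⨆ j, ⨆ _ : p j, Submodule.span F {v j}) ↔ ∀ j, ¬ p j → v.coord j w = 0 := by
  classical
  constructor
  · intro hw j hj
    have hle : (⨆ i, ⨆ _ : p i, Submodule.span F {v i}) ≤ LinearMap.ker (v.coord j) := by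
      refine iSup_le fun i => iSup_le fun hi => ?_
      rw [Submodule.span_singleton_le_iff_mem, LinearMap.mem_ker]
      have hij : i ≠ j := fun h => hj (h ▸ hi)
      simp [hij]
    exact LinearMap.mem_ker.1 (hle hw)
  · intro h
    rw [← v.sum_repr w]
    refine Submodule.sum_mem _ fun i _ => ?_
    by_cases hi : p i
    · refine Submodule.smul_mem _ _ ?_
      exact Submodule.mem_iSup_of_mem i (Submodule.mem_iSup_of_mem hi
        (Submodule.mem_span_singleton_self _))
    · have := h i hi
      rw [Module.Basis.coord_apply] at this
      rw [this, zero_smul]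
      exact Submodule.zero_mem _

theorem IsStandardIdempotents.exists_basis {F V : Type*} [Field F] [AddCommGroup V] [Module F V]
    {d : ℕ} {A B : Module.End F V} {E : Fin (d + 1) → Module.End F V}
    (hd : ⨆ θ : F, A.eigenspace θ = ⊤) (h : IsStandardIdempotents A B E)
    (h1 : ∀ i, Module.finrank F (LinearMap.range (E i)) = 1) :
    ∃ (θ : Fin (d + 1) → F) (v : Module.Basis (Fin (d + 1)) F V), Function.Injective θ ∧
      (∀ i, A (v i) = θ i • v i) ∧ (∀ i, LinearMap.range (E i) = Submodule.span F {v i}) ∧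
      ∀ i j : Fin (d + 1), ¬ ((j : ℕ) ≤ (i : ℕ) + 1 ∧ (i : ℕ) ≤ (j : ℕ) + 1) →
        v.coord j (B (v i)) = 0 := by
  obtain ⟨W, ⟨⟨hinj, hran⟩, htri⟩, hE⟩ := h
  have hW : ∀ i, W i ≠ ⊥ ∧ ∃ θ : F, W i = A.eigenspace θ := fun i => by
    have : W i ∈ Set.range W := ⟨i, rfl⟩
    rwa [hran] at this
  choose hne θ hθ using hW
  have hθinj : Function.Injective θ := fun i j hij => hinj (by rw [hθ, hθ, hij])
  have htop : ⨆ i, W i = ⊤ := by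
    rw [eq_top_iff, ← hd]
    refine iSup_le fun μ => ?_
    by_cases hμ : A.eigenspace μ = ⊥
    · rw [hμ]; exact bot_le
    · have : A.eigenspace μ ∈ Set.range W := by rw [hran]; exact ⟨hμ, μ, rfl⟩
      obtain ⟨i, hi⟩ := this
      rw [← hi]; exact le_iSup W i
  have hrange : ∀ i, LinearMap.range (E i) = W i := fun i => by
    apply le_antisymm
    · rw [LinearMap.range_eq_map, ← htop, Submodule.map_iSup]
      refine iSup_le fun j => ?_
      rintro _ ⟨w, hw, rfl⟩
      by_cases hj : j = i
      · subst hj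
        rw [(hE j).1 w hw]; exact hw
      · rw [(hE i).2 j hj w hw]; exact Submodule.zero_mem _
    · intro w hw
      exact ⟨w, (hE i).1 w hw⟩
  have hv : ∀ i, ∃ v ∈ W i, v ≠ 0 := fun i => (Submodule.ne_bot_iff _).1 (hne i)
  choose v hvW hv0 using hv
  have hspan : ∀ i, W i = Submodule.span F {v i} := fun i => by
    have h1' := h1 i
    rw [hrange] at h1'
    apply le_antisymm
    · intro w hw
      obtain ⟨c, hc⟩ := (finrank_eq_one_iff_of_nonzero' (⟨v i, hvW i⟩ : W i)
        (by simpa [Subtype.ext_iff] using hv0 i)).1 h1' ⟨w, hw⟩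
      exact Submodule.mem_span_singleton.2 ⟨c, congrArg Subtype.val hc⟩
    · rw [Submodule.span_singleton_le_iff_mem]; exact hvW i
  have hli : LinearIndependent F v :=
    Module.End.eigenvectors_linearIndependent' A θ hθinj v fun i =>
      ⟨(hθ i).le (hvW i), hv0 i⟩
  have hsp : ⊤ ≤ Submodule.span F (Set.range v) := by
    rw [← htop]
    refine iSup_le fun i => ?_
    rw [hspan]
    exact Submodule.span_mono (by rintro _ rfl; exact ⟨i, rfl⟩)
  refine ⟨θ, Module.Basis.mk hli hsp, hθinj, fun i => ?_, fun i => ?_, fun i j hij => ?_⟩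
  · rw [Module.Basis.mk_apply]
    have := hvW i
    rw [hθ] at this
    exact Module.End.mem_eigenspace_iff.1 this
  · rw [Module.Basis.mk_apply, hrange, hspan]
  · have hm := htri i (Submodule.mem_map_of_mem (f := B) (hvW i))
    have := (Module.Basis.mem_iSup_span_iff (Module.Basis.mk hli hsp)
      (fun j : Fin (d + 1) => (j : ℕ) ≤ (i : ℕ) + 1 ∧ (i : ℕ) ≤ (j : ℕ) + 1) (B (v i))).1
    simp only [Module.Basis.mk_apply, ← hspan] at this ⊢
    exact this hm j hij

theorem IsStandardIdempotents.exists_eigenCoords {F V : Type*} [Field F] [AddCommGroup V]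
    [Module F V] {d : ℕ} {A B : Module.End F V} {E : Fin (d + 1) → Module.End F V}
    (hd : ⨆ θ : F, A.eigenspace θ = ⊤) (h : IsStandardIdempotents A B E)
    (h1 : ∀ i, Module.finrank F (LinearMap.range (E i)) = 1) :
    ∃ (θ : ℕ → F) (e : ℕ → V →ₗ[F] F), EigenCoords A B d θ e ∧
      (∀ i : Fin (d + 1), eigenvalueOn A (LinearMap.range (E i)) = θ i) ∧
      ∀ (p : Fin (d + 1) → Prop) (w : V), (w ∈ ⨆ j, ⨆ _ : p j, LinearMap.range (E j)) ↔
        ∀ j : Fin (d + 1), ¬ p j → e j w = 0 := by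
  classical
  obtain ⟨θ, v, hinj, heig, hran, htri⟩ := h.exists_basis hd h1
  have hA : ∀ (j : Fin (d + 1)) w, v.coord j (A w) = θ j * v.coord j w := by
    intro j w
    have : v.coord j ∘ₗ A = θ j • v.coord j := by
      refine v.ext fun i => ?_
      by_cases hij : i = j
      · subst hij; simp [heig]
      · simp [heig, hij]
    simpa using LinearMap.congr_fun this w
  let e : ℕ → V →ₗ[F] F := fun j => if hj : j < d + 1 then v.coord ⟨j, hj⟩ else 0
  have he : ∀ j (hj : j < d + 1), e j = v.coord ⟨j, hj⟩ := fun j hj => dif_pos hj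
  have he' : ∀ j : Fin (d + 1), e j = v.coord j := fun j => he j j.2
  have he0 : ∀ j, d < j → e j = 0 := fun j hj => dif_neg (by omega)
  have hev : ∀ (j : ℕ) (i : Fin (d + 1)), e j (v i) = if j = i then 1 else 0 := by
    intro j i
    by_cases hj : j < d + 1
    · rw [he j hj]
      simp [Finsupp.single_apply, Fin.ext_iff, eq_comm]
    · rw [he0 j (by omega)]
      have := i.2
      rw [if_neg (by omega)]; rfl
  refine ⟨fun j => if hj : j < d + 1 then θ ⟨j, hj⟩ else 0, e, ⟨?_, ?_, he0, ?_, ?_, ?_⟩, ?_, ?_⟩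
  · intro w hw
    refine v.ext_elem fun j => ?_
    have := hw j (by omega)
    rw [he'] at this
    simpa using this
  · intro i hi
    refine ⟨v ⟨i, by omega⟩, by simp [hev], fun j hj => by simp [hev, hj]⟩
  · intro j w
    by_cases hj : j < d + 1
    · simp only [he j hj, dif_pos hj, hA]
    · simp [he0 j (by omega)]
  · intro i
    by_cases hi : i < d + 1
    · have key : ∃ x y z : F, e i ∘ₗ B = x • e (i - 1) + y • e i + z • e (i + 1) := by
        -- At `i = 0` truncated subtraction makes `e (i - 1)` equal to `e 0`, so the first
        -- coefficient is set to `0` to avoid counting the diagonal entry twice.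
        refine ⟨if hi0 : 0 < i then e i (B (v ⟨i - 1, by omega⟩)) else 0, e i (B (v ⟨i, hi⟩)),
          if hid : i + 1 < d + 1 then e i (B (v ⟨i + 1, hid⟩)) else 0, ?_⟩
        refine v.ext fun k => ?_
        simp only [LinearMap.comp_apply, LinearMap.add_apply, LinearMap.smul_apply, hev,
          smul_eq_mul]
        obtain ⟨k, hk⟩ := k
        by_cases h1 : k + 1 = i
        · subst h1
          have : k + 1 + 1 ≠ k := by omega
          simp [this]
        by_cases h2 : k = i
        · subst h2
          by_cases h0 : 0 < k
          · have : k - 1 ≠ k := by omega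
            simp [this]
          · simp [h0]
        by_cases h3 : k = i + 1
        · subst h3
          have : i - 1 ≠ i + 1 := by omega
          simp [this, hk]
        · have := htri ⟨k, hk⟩ ⟨i, hi⟩ (by simp only; omega)
          rw [he i hi, this]
          by_cases h0 : 0 < i
          · have : i - 1 ≠ k := by omega
            simp [this, Ne.symm h2, Ne.symm h3]
          · simp [h0, Ne.symm h2, Ne.symm h3]
      obtain ⟨x, y, z, hk⟩ := key
      exact ⟨x, y, z, fun w => by simpa using LinearMap.congr_fun hk w⟩
    · exact ⟨0, 0, 0, fun w => by simp [he0 i (by omega)]⟩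
  · intro i j hi hj hij
    simp only [dif_pos (show i < d + 1 by omega), dif_pos (show j < d + 1 by omega)] at hij
    exact congrArg Fin.val (hinj hij)
  · intro i
    simp only [dif_pos i.2]
    refine eigenvalueOn_eq (w := v i) (fun w hw => ?_) ?_ (v.ne_zero i)
    · rw [hran] at hw
      obtain ⟨c, rfl⟩ := Submodule.mem_span_singleton.1 hw
      rw [map_smul, heig, smul_comm]
    · rw [hran]; exact Submodule.mem_span_singleton_self _
  · intro p w
    simp only [hran, he']
    exact v.mem_iSup_span_iff p w

/-! ### Symmetric q-binomials and a q-Chu–Vandermonde identity -/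

/-- Symmetric `q`-binomial coefficients. -/
def symmQBinom {K : Type*} [Field K] (q : K) : ℕ → ℕ → K
  | _, 0 => 1
  | 0, _ + 1 => 0
  | n + 1, m + 1 => symmQBinom q n (m + 1) * q ^ (-((m : ℤ) + 1)) +
      symmQBinom q n m * q ^ ((n : ℤ) - m)

section
variable {K : Type*} [Field K] {q : K}

@[simp] theorem symmQBinom_zero_right (q : K) (n : ℕ) : symmQBinom q n 0 = 1 := by
  cases n <;> rfl

theorem symmQBinom_succ_succ (q : K) (n m : ℕ) : symmQBinom q (n + 1) (m + 1) =
    symmQBinom q n (m + 1) * q ^ (-((m : ℤ) + 1)) + symmQBinom q n m * q ^ ((n : ℤ) - m) := rfl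

theorem symmQBinom_eq_zero (q : K) {n m : ℕ} (h : n < m) : symmQBinom q n m = 0 := by
  induction n generalizing m with
  | zero => obtain ⟨m, rfl⟩ := Nat.exists_eq_succ_of_ne_zero (by omega : m ≠ 0); rfl
  | succ n ih =>
    obtain ⟨m, rfl⟩ := Nat.exists_eq_succ_of_ne_zero (by omega : m ≠ 0)
    rw [symmQBinom_succ_succ, ih (by omega), ih (by omega)]; ring

/-- The ratio of neighbours in a row of the q-Pascal triangle, cleared of denominators so that it
also holds at roots of unity. -/
theorem symmQBinom_mul_succ (hq : q ≠ 0) (n m : ℕ) :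
    (q ^ ((m : ℤ) + 1) - q ^ (-((m : ℤ) + 1))) * symmQBinom q n (m + 1) =
      (q ^ ((n : ℤ) - m) - q ^ ((m : ℤ) - n)) * symmQBinom q n m := by
  induction n generalizing m with
  | zero =>
    rcases m with _ | m
    · simp [symmQBinom]
    · simp [symmQBinom]
  | succ n ih =>
    rw [symmQBinom_succ_succ]
    rcases m with _ | m
    · have := ih 0
      simp only [symmQBinom_zero_right, Nat.cast_zero, zero_add, sub_zero, mul_one] at this ⊢
      rw [mul_add, ← mul_assoc, this]
      push_cast
      simp only [zpow_add₀ hq, zpow_sub₀ hq, zpow_neg, zpow_one]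
      field_simp
      ring
    · have h1 := ih (m + 1)
      have h2 := ih m
      rw [symmQBinom_succ_succ]
      push_cast at h1 h2 ⊢
      rw [mul_add, ← mul_assoc, h1]
      set X := symmQBinom q n (m + 1)
      set Y := symmQBinom q n m
      simp only [zpow_add₀ hq, zpow_sub₀ hq, zpow_neg, zpow_one, neg_add] at h2 ⊢
      have hm : q ^ (m : ℤ) ≠ 0 := zpow_ne_zero _ hq
      have hn : q ^ (n : ℤ) ≠ 0 := zpow_ne_zero _ hq
      generalize q ^ (m : ℤ) = M at *
      generalize q ^ (n : ℤ) = N at *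
      field_simp at h2 ⊢
      linear_combination (N * q ^ 2) * h2

/-- The Pascal rule with q replaced by its inverse; it differs from the defining rule exactly by
`symmQBinom_mul_succ`. -/
theorem symmQBinom_succ_succ' (hq : q ≠ 0) (n m : ℕ) : symmQBinom q (n + 1) (m + 1) =
    symmQBinom q n (m + 1) * q ^ ((m : ℤ) + 1) + symmQBinom q n m * q ^ ((m : ℤ) - n) := by
  have := symmQBinom_mul_succ hq n m
  rw [symmQBinom_succ_succ]
  linear_combination -this

/-- A `q`-analogue of the Chu–Vandermonde identity for the nodes
`α δ q ^ (-2 k) + β γ q ^ (2 k)`. -/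
theorem sum_symmQBinom_mul_prod (hq : q ≠ 0) (n : ℕ) (α β γ δ l : K) :
    ∑ m ∈ Finset.range (n + 1), symmQBinom q n m *
      (∏ k ∈ Finset.range m, (α * δ * q ^ (-(2 * (k : ℤ))) + β * γ * q ^ (2 * (k : ℤ)) - l)) *
      (∏ j ∈ Finset.range (n - m), (α - β * q ^ ((n : ℤ) - 1 - 2 * j)) *
        (γ - δ * q ^ (2 * (j : ℤ) + 1 - n))) =
    ∏ j ∈ Finset.range n,
      (α * γ * q ^ ((n : ℤ) - 1 - 2 * j) + β * δ * q ^ (2 * (j : ℤ) + 1 - n) - l) := by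
  induction n generalizing β γ with
  | zero => simp
  | succ n ih =>
    rw [Finset.prod_range_succ]
    -- This substitution preserves βγ, hence all the nodes, and turns the product on the right into
    -- the first n factors of the product wanted.
    have h1 := ih (β / q) (γ * q)
    have h2 : ∀ j ∈ Finset.range n,
        α * (γ * q) * q ^ ((n : ℤ) - 1 - 2 * j) + β / q * δ * q ^ (2 * (j : ℤ) + 1 - n) - l =
        α * γ * q ^ (((n + 1 : ℕ) : ℤ) - 1 - 2 * j) +
          β * δ * q ^ (2 * (j : ℤ) + 1 - (n + 1 : ℕ)) - l := by
      intro j _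
      push_cast
      simp only [zpow_add₀ hq, zpow_sub₀ hq, zpow_one]
      field_simp
    rw [Finset.prod_congr rfl h2] at h1
    rw [← h1, Finset.sum_mul]
    clear h1 h2 ih
    set N : ℕ → K := fun m => ∏ k ∈ Finset.range m,
      (α * δ * q ^ (-(2 * (k : ℤ))) + β * γ * q ^ (2 * (k : ℤ)) - l) with hN
    set a : ℕ → K := fun j => α - β * q ^ ((n : ℤ) - 2 * j) with ha
    set g : ℕ → K := fun j => γ - δ * q ^ (2 * (j : ℤ) - n) with hg
    set Q : ℕ → K := fun i => (∏ j ∈ Finset.range i, a (j + 1)) * ∏ j ∈ Finset.range i, g j with hQ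
    have hNs : ∀ m, N (m + 1) = N m *
      (α * δ * q ^ (-(2 * (m : ℤ))) + β * γ * q ^ (2 * (m : ℤ)) - l) := fun m =>
        Finset.prod_range_succ _ _
    -- The remaining factor αγq^{-n} + βδq^n - l equals the m-th node factor plus q^{-n}(α -
    -- βq^{2m+n})(γ - δq^{n-2m}). The first summand extends `N m` to `N (m + 1)`, the second extends
    -- the product of the `g j`.
    have hterm : ∀ m ∈ Finset.range (n + 1), symmQBinom q n m *
        (∏ k ∈ Finset.range m,
          (α * δ * q ^ (-(2 * (k : ℤ))) + β / q * (γ * q) * q ^ (2 * (k : ℤ)) - l)) *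
        (∏ j ∈ Finset.range (n - m), (α - β / q * q ^ ((n : ℤ) - 1 - 2 * j)) *
          (γ * q - δ * q ^ (2 * (j : ℤ) + 1 - n))) *
        (α * γ * q ^ (((n + 1 : ℕ) : ℤ) - 1 - 2 * n) +
          β * δ * q ^ (2 * (n : ℤ) + 1 - (n + 1 : ℕ)) - l) =
        symmQBinom q n m * q ^ ((n : ℤ) - m) * Q (n - m) * N (m + 1) +
        symmQBinom q n m * q ^ (-(m : ℤ)) * (α - β * q ^ (2 * (m : ℤ) + n)) *
          (Q (n - m) * g (n - m)) * N m := by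
      intro m hm
      have hm' : m ≤ n := by simpa [Nat.lt_succ_iff] using hm
      have e1 : (∏ j ∈ Finset.range (n - m), (α - β / q * q ^ ((n : ℤ) - 1 - 2 * j)) *
          (γ * q - δ * q ^ (2 * (j : ℤ) + 1 - n))) = q ^ ((n : ℤ) - m) * Q (n - m) := by
        have : ∀ j ∈ Finset.range (n - m), (α - β / q * q ^ ((n : ℤ) - 1 - 2 * j)) *
          (γ * q - δ * q ^ (2 * (j : ℤ) + 1 - n)) = q * (a (j + 1) * g j) := by
          intro j _
          simp only [ha, hg]
          push_cast
          have : (n : ℤ) - 2 * (j + 1) = (n : ℤ) - 1 - 2 * j - 1 := by ring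
          rw [this]
          have : 2 * (j : ℤ) + 1 - n = 2 * (j : ℤ) - n + 1 := by ring
          rw [this, zpow_sub₀ hq _ 1, zpow_add₀ hq _ 1, zpow_one]
          field_simp
        rw [Finset.prod_congr rfl this, Finset.prod_mul_distrib, Finset.prod_const,
          Finset.card_range, Finset.prod_mul_distrib, hQ, ← zpow_natCast, Nat.cast_sub hm']
      have e2 : (∏ k ∈ Finset.range m,
          (α * δ * q ^ (-(2 * (k : ℤ))) + β / q * (γ * q) * q ^ (2 * (k : ℤ)) - l)) = N m := by
        refine Finset.prod_congr rfl fun k _ => ?_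
        field_simp
      rw [e1, e2, hNs]
      simp only [hg, Nat.cast_sub hm']
      push_cast
      generalize symmQBinom q n m = B
      generalize N m = M
      generalize Q (n - m) = R
      have x1 : (n : ℤ) + 1 - 1 - 2 * n = -n := by ring
      have x2 : 2 * (n : ℤ) + 1 - (n + 1) = n := by ring
      have x3 : 2 * ((n : ℤ) - m) - n = n - 2 * m := by ring
      rw [x1, x2, x3]
      simp only [zpow_add₀ hq, zpow_sub₀ hq, zpow_neg, mul_comm (2 : ℤ), zpow_mul]
      have hm : q ^ (m : ℤ) ≠ 0 := zpow_ne_zero _ hq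
      have hn : q ^ (n : ℤ) ≠ 0 := zpow_ne_zero _ hq
      generalize q ^ (m : ℤ) = M at *
      generalize q ^ (n : ℤ) = N at *
      have : ∀ x : K, x ^ (2 : ℤ) = x ^ 2 := fun x => by norm_cast
      simp only [this]
      field_simp
      ring
    rw [Finset.sum_congr rfl hterm, Finset.sum_add_distrib]
    have hA : ∀ i, ∏ j ∈ Finset.range (i + 1), a j = a 0 * ∏ j ∈ Finset.range i, a (j + 1) :=
      fun i => by rw [Finset.prod_range_succ', mul_comm]
    have hterm' : ∀ m ∈ Finset.range (n + 1 + 1), symmQBinom q (n + 1) m *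
        (∏ k ∈ Finset.range m,
          (α * δ * q ^ (-(2 * (k : ℤ))) + β * γ * q ^ (2 * (k : ℤ)) - l)) *
        (∏ j ∈ Finset.range (n + 1 - m), (α - β * q ^ (((n + 1 : ℕ) : ℤ) - 1 - 2 * j)) *
          (γ - δ * q ^ (2 * (j : ℤ) + 1 - (n + 1 : ℕ)))) =
        symmQBinom q (n + 1) m * N m * ((∏ j ∈ Finset.range (n + 1 - m), a j) *
          ∏ j ∈ Finset.range (n + 1 - m), g j) := by
      intro m _
      congr 1
      rw [← Finset.prod_mul_distrib]
      refine Finset.prod_congr rfl fun j _ => ?_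
      simp only [ha, hg]
      push_cast
      have x1 : (n : ℤ) + 1 - 1 - 2 * j = n - 2 * j := by ring
      have x2 : 2 * (j : ℤ) + 1 - (n + 1) = 2 * j - n := by ring
      rw [x1, x2]
    rw [Finset.sum_congr rfl hterm']
    rw [Finset.sum_range_succ' _ (n + 1), Finset.sum_range_succ' (fun m : ℕ => symmQBinom q n m *
      q ^ (-(m : ℤ)) * (α - β * q ^ (2 * (m : ℤ) + n)) * (Q (n - m) * g (n - m)) * N m) n]
    -- The extra term `m = n` vanishes with its binomial; it makes the two sums have the same range,
    -- so that coefficients of `N (m + 1)` can be compared.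
    have hlast : ∑ m ∈ Finset.range (n + 1), symmQBinom q n (m + 1) * q ^ (-((m : ℤ) + 1)) *
        (α - β * q ^ (2 * ((m : ℤ) + 1) + n)) * (Q (n - (m + 1)) * g (n - (m + 1))) * N (m + 1) =
        ∑ m ∈ Finset.range n, symmQBinom q n (m + 1) * q ^ (-((m : ℤ) + 1)) *
        (α - β * q ^ (2 * ((m : ℤ) + 1) + n)) * (Q (n - (m + 1)) * g (n - (m + 1))) * N (m + 1) := by
      rw [Finset.sum_range_succ, symmQBinom_eq_zero q (Nat.lt_succ_self n)]
      ring
    push_cast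
    rw [← hlast, ← add_assoc, ← Finset.sum_add_distrib]
    congr 1
    · refine Finset.sum_congr rfl fun m hm => ?_
      have hm' : m ≤ n := by simpa [Nat.lt_succ_iff] using hm
      have hP1 := symmQBinom_succ_succ q n m
      have hP2 := symmQBinom_succ_succ' hq n m
      rcases Nat.eq_or_lt_of_le hm' with rfl | hlt
      · rw [Nat.sub_self]
        rw [symmQBinom_eq_zero q (Nat.lt_succ_self m)] at hP1 ⊢
        rw [hP1]
        simp [hQ]
      · obtain ⟨i, hi⟩ : ∃ i, n - m = i + 1 := ⟨n - m - 1, by omega⟩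
        have hi' : n - (m + 1) = i := by omega
        rw [hi, hi', hA]
        simp only [hQ]
        rw [Finset.prod_range_succ _ i, Finset.prod_range_succ _ i]
        have hai : a (i + 1) = α - β * q ^ (2 * (m : ℤ) - n) := by
          simp only [ha]
          congr 3
          have : (n : ℤ) - m = i + 1 := by omega
          push_cast
          linarith
        have ha0 : a 0 = α - β * q ^ (n : ℤ) := by simp [ha]
        rw [hai, ha0]
        -- The coefficient of α is one Pascal rule, the coefficient of β is the other.
        have key : symmQBinom q (n + 1) (m + 1) * (α - β * q ^ (n : ℤ)) =
            symmQBinom q n m * q ^ ((n : ℤ) - m) * (α - β * q ^ (2 * (m : ℤ) - n)) +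
            symmQBinom q n (m + 1) * q ^ (-((m : ℤ) + 1)) *
              (α - β * q ^ (2 * ((m : ℤ) + 1) + n)) := by
          rw [mul_sub]
          nth_rewrite 1 [hP1]
          rw [hP2]
          simp only [zpow_add₀ hq, zpow_sub₀ hq, zpow_neg, mul_comm (2 : ℤ), zpow_mul, zpow_one]
          have hm : q ^ (m : ℤ) ≠ 0 := zpow_ne_zero _ hq
          have hn : q ^ (n : ℤ) ≠ 0 := zpow_ne_zero _ hq
          generalize q ^ (m : ℤ) = M at *
          generalize q ^ (n : ℤ) = N at *
          have : ∀ x : K, x ^ (2 : ℤ) = x ^ 2 := fun x => by norm_cast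
          simp only [this]
          field_simp
          ring
        linear_combination (N (m + 1) * (∏ j ∈ Finset.range i, a (j + 1)) *
          (∏ j ∈ Finset.range i, g j) * g i) * key
    · simp only [hQ, Nat.sub_zero, symmQBinom_zero_right]
      rw [hA, Finset.prod_range_succ _ n]
      simp [ha, hN]
      ring
end

/-! ### The split decomposition in coordinates -/

/-- The vectors `(A - θ_{i-1}) ⋯ (A - θ_0) u`. -/
def splitVec {F V : Type*} [Field F] [AddCommGroup V] [Module F V] (A : Module.End F V)
    (θ : ℕ → F) (u : V) : ℕ → V
  | 0 => u
  | i + 1 => A (splitVec A θ u i) - θ i • splitVec A θ u i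

namespace EigenCoords

variable {F V : Type*} [Field F] [AddCommGroup V] [Module F V] {A As : Module.End F V} {d : ℕ}
  {θ θs : ℕ → F} {e f : ℕ → V →ₗ[F] F}

theorem tri_eq_zero (hS : EigenCoords As A d θs f) {w : V} {n : ℕ}
    (h1 : f (n - 1) w = 0) (h2 : f n w = 0) (h3 : f (n + 1) w = 0) : f n (A w) = 0 := by
  obtain ⟨x, y, z, h⟩ := hS.tri n
  rw [h, h1, h2, h3]; ring

/-- Irreducibility: if the entry of A from E*_n V to E*_{n+1} V vanished, E*_0 V + ⋯ + E*_n V would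
be a proper nonzero subspace invariant under A and A*. -/
theorem coord_eq_zero (hS : EigenCoords As A d θs f) (hp : IsTridiagonalPair A As) {n : ℕ}
    (hn : n < d) {w : V} (hw : ∀ j, n < j → f j w = 0) (h : f (n + 1) (A w) = 0) :
    f n w = 0 := by
  obtain ⟨x, y, z, hx⟩ := hS.tri (n + 1)
  by_contra hne
  rw [hx, hw (n + 1) (by omega), hw (n + 1 + 1) (by omega)] at h
  have hx0 : x = 0 := by simpa [hne] using h
  refine hp.irreducible ⟨⨅ j, ⨅ _ : n < j, LinearMap.ker (f j), ?_, ?_, ?_, ?_⟩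
  · rintro _ ⟨v, hv, rfl⟩
    simp only [SetLike.mem_coe, Submodule.mem_iInf, LinearMap.mem_ker] at hv ⊢
    intro j hj
    by_cases hj1 : j = n + 1
    · subst hj1
      rw [hx, hx0, hv (n + 1) (by omega), hv (n + 1 + 1) (by omega)]; ring
    · exact hS.tri_eq_zero (hv _ (by omega)) (hv _ (by omega)) (hv _ (by omega))
  · rintro _ ⟨v, hv, rfl⟩
    simp only [SetLike.mem_coe, Submodule.mem_iInf, LinearMap.mem_ker] at hv ⊢
    intro j hj
    rw [hS.eig, hv j hj, mul_zero]
  · rw [Submodule.ne_bot_iff]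
    refine ⟨w, ?_, fun h0 => hne (by rw [h0, map_zero])⟩
    simpa only [Submodule.mem_iInf, LinearMap.mem_ker] using hw
  · intro htop
    obtain ⟨v, hv1, -⟩ := hS.exists_dual d le_rfl
    have hv : v ∈ ⨅ j, ⨅ _ : n < j, LinearMap.ker (f j) := htop ▸ Submodule.mem_top
    simp only [Submodule.mem_iInf, LinearMap.mem_ker] at hv
    exact one_ne_zero (hv1.symm.trans (hv d hn))

/-- The sums E*_0 V + ⋯ + E*_{i-1} V and E_i V + ⋯ + E_d V meet trivially; this makes each U_i at
most a line. -/
theorem eq_zero_of_mem_inter (hE : EigenCoords A As d θ e) (hS : EigenCoords As A d θs f)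
    (hp : IsTridiagonalPair A As) {i : ℕ} (hi : i ≤ d + 1) {w : V}
    (hf : ∀ j, i ≤ j → f j w = 0) (he : ∀ j, j < i → e j w = 0) : w = 0 := by
  obtain ⟨k, hk⟩ : ∃ k, i + k = d + 1 := ⟨d + 1 - i, by omega⟩
  induction k generalizing i w with
  | zero => exact hE.ext w fun j hj => he j (by omega)
  | succ k ih =>
    -- Applying A - θ_i moves w into the same intersection for `i + 1`, which is zero by induction.
    -- So w is an eigenvector of A.
    have h1 : A w - θ i • w = 0 := by
      refine ih (i := i + 1) (by omega) (fun j hj => ?_) (fun j hj => ?_) (by omega)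
      · rw [map_sub, map_smul, hf j (by omega), hS.tri_eq_zero (hf _ (by omega)) (hf _ (by omega))
          (hf _ (by omega))]
        simp
      · rw [map_sub, map_smul, hE.eig]
        rcases Nat.lt_succ_iff_lt_or_eq.1 hj with h | rfl
        · simp [he j h]
        · simp
    have h2 : A w = θ i • w := sub_eq_zero.1 h1
    -- An eigenvector of A loses its dual coordinates one at a time from the top, by
    -- `coord_eq_zero`; `m = i` reaches them all.
    have h3 : ∀ m j, i - m ≤ j → f j w = 0 := by
      intro m
      induction m with
      | zero => exact fun j hj => hf j (by omega)
      | succ m ihm =>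
        intro j hj
        by_cases hj' : i - m ≤ j
        · exact ihm j hj'
        · refine hS.coord_eq_zero hp (by omega) (fun j' hj'' => ihm j' (by omega)) ?_
          rw [h2, map_smul, ihm (j + 1) (by omega), smul_zero]
    exact hS.ext w fun j _ => h3 i j (by omega)

variable {u : V}

theorem lower_splitVec (hS : EigenCoords As A d θs f) (hu : ∀ j, 0 < j → f j u = 0) (i : ℕ) :
    ∀ j, i < j → f j (splitVec A θ u i) = 0 := by
  induction i with
  | zero => exact hu
  | succ i ih =>
    intro j hj
    rw [splitVec, map_sub, map_smul, ih j (by omega),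
      hS.tri_eq_zero (ih _ (by omega)) (ih _ (by omega)) (ih _ (by omega))]
    simp

theorem apply_splitVec (hE : EigenCoords A As d θ e) (j i : ℕ) :
    e j (splitVec A θ u i) = (∏ h ∈ Finset.range i, (θ j - θ h)) * e j u := by
  induction i with
  | zero => simp [splitVec]
  | succ i ih =>
    rw [splitVec, map_sub, map_smul, hE.eig, ih, Finset.prod_range_succ, smul_eq_mul]
    ring

theorem upper_splitVec (hE : EigenCoords A As d θ e) {i j : ℕ} (hij : j < i) :
    e j (splitVec A θ u i) = 0 := by
  rw [hE.apply_splitVec, Finset.prod_eq_zero (Finset.mem_range.2 hij) (sub_self _), zero_mul]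

theorem splitVec_coord_ne_zero (hS : EigenCoords As A d θs f) (hp : IsTridiagonalPair A As)
    (hu : ∀ j, 0 < j → f j u = 0) (hu0 : f 0 u ≠ 0) {i : ℕ} (hi : i ≤ d) :
    f i (splitVec A θ u i) ≠ 0 := by
  induction i with
  | zero => exact hu0
  | succ i ih =>
    intro h
    refine ih (by omega) (hS.coord_eq_zero hp (by omega) (hS.lower_splitVec hu i) ?_)
    rwa [splitVec, map_sub, map_smul, hS.lower_splitVec hu i (i + 1) (by omega), smul_zero,
      sub_zero] at h

theorem eq_smul_splitVec (hE : EigenCoords A As d θ e) (hS : EigenCoords As A d θs f)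
    (hp : IsTridiagonalPair A As) (hu : ∀ j, 0 < j → f j u = 0) (hu0 : f 0 u ≠ 0) {i : ℕ}
    (hi : i ≤ d) {w : V} (hf : ∀ j, i < j → f j w = 0) (he : ∀ j, j < i → e j w = 0) :
    ∃ c : F, w = c • splitVec A θ u i := by
  have hne := hS.splitVec_coord_ne_zero (θ := θ) hp hu hu0 hi
  refine ⟨f i w / f i (splitVec A θ u i), sub_eq_zero.1 ?_⟩
  refine hE.eq_zero_of_mem_inter hS hp (i := i) (by omega) (fun j hj => ?_) (fun j hj => ?_)
  · rw [map_sub, map_smul, smul_eq_mul]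
    rcases Nat.eq_or_lt_of_le hj with rfl | h
    · field_simp
      simp
    · rw [hf j h, hS.lower_splitVec hu i j h]; ring
  · rw [map_sub, map_smul, he j hj, hE.upper_splitVec hj]; simp

/-- A* - θ*_{i+1} kills the top dual coordinate and, by tridiagonality, lowers the first possible
nonzero A-coordinate by at most one. Hence it maps U_{i+1} into the line U_i. -/
theorem exists_split_scalar (hE : EigenCoords A As d θ e) (hS : EigenCoords As A d θs f)
    (hp : IsTridiagonalPair A As) (hu : ∀ j, 0 < j → f j u = 0) (hu0 : f 0 u ≠ 0) {i : ℕ}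
    (hi : i < d) : ∃ c : F,
      As (splitVec A θ u (i + 1)) = θs (i + 1) • splitVec A θ u (i + 1) + c • splitVec A θ u i := by
  suffices h : ∃ c : F, As (splitVec A θ u (i + 1)) - θs (i + 1) • splitVec A θ u (i + 1) =
      c • splitVec A θ u i by
    obtain ⟨c, hc⟩ := h
    exact ⟨c, by rw [← hc, add_sub_cancel]⟩
  refine hE.eq_smul_splitVec hS hp hu hu0 (by omega) (fun j hj => ?_) (fun j hj => ?_)
  · rw [map_sub, map_smul, hS.eig]
    rcases Nat.eq_or_lt_of_le hj with rfl | h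
    · simp
    · rw [hS.lower_splitVec hu (i + 1) j h]; simp
  · rw [map_sub, map_smul, hE.upper_splitVec (by omega), hE.tri_eq_zero
      (hE.upper_splitVec (by omega)) (hE.upper_splitVec (by omega)) (hE.upper_splitVec (by omega))]
    simp

/-- Only the d-th A-coordinate of the last split vector can be nonzero, it is a multiple of `e d u`,
and that vector is not zero. -/
theorem last_coord_ne_zero (hE : EigenCoords A As d θ e) (hS : EigenCoords As A d θs f)
    (hp : IsTridiagonalPair A As) (hu : ∀ j, 0 < j → f j u = 0) (hu0 : f 0 u ≠ 0) :
    e d u ≠ 0 := by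
  intro h
  have h0 : splitVec A θ u d = 0 := hE.ext _ fun j hj => by
    rcases Nat.eq_or_lt_of_le hj with rfl | hlt
    · rw [hE.apply_splitVec, h, mul_zero]
    · exact hE.upper_splitVec hlt
  exact hS.splitVec_coord_ne_zero (θ := θ) hp hu hu0 le_rfl (by rw [h0, map_zero])

/-- Tridiagonality of `A*` at the last eigenspace of `A` determines the first split sequence up
to one free scalar. -/
theorem exists_split_formula (hE : EigenCoords A As d θ e) (hu : As u = θs 0 • u)
    (hu0 : e d u ≠ 0) {φ : ℕ → F}
    (hφ : ∀ i < d, As (splitVec A θ u (i + 1)) =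
      θs (i + 1) • splitVec A θ u (i + 1) + φ (i + 1) • splitVec A θ u i) :
    ∃ x : F, ∀ i < d, φ (i + 1) * ∏ h ∈ Finset.range i, (θ d - θ h) =
      (x - θs (i + 1)) * ∏ h ∈ Finset.range (i + 1), (θ d - θ h) +
        (θs 0 - x) * ∏ h ∈ Finset.range (i + 1), (θ (d - 1) - θ h) := by
  obtain ⟨x, y, z, h⟩ := hE.tri d
  have h0 : e (d + 1) = 0 := hE.zero _ (by omega)
  simp only [h0, LinearMap.zero_apply, mul_zero, add_zero] at h
  have hu1 := h u
  rw [hu, map_smul, smul_eq_mul] at hu1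
  -- The free scalar is the last diagonal entry of A*. The other entry occurs only as x times `e (d
  -- - 1) u`, which `hu1` expresses through `e d u`.
  refine ⟨y, fun i hi => ?_⟩
  have h1 := h (splitVec A θ u (i + 1))
  rw [hφ i hi, map_add, map_smul, map_smul, smul_eq_mul, smul_eq_mul] at h1
  simp only [hE.apply_splitVec] at h1
  refine mul_right_cancel₀ hu0 ?_
  linear_combination h1 - hu1 * ∏ h ∈ Finset.range (i + 1), (θ (d - 1) - θ h)

end EigenCoords

/-! ### Split sequences of a Leonard system -/

namespace TridiagonalSystem

variable {F V : Type*} [Field F] [AddCommGroup V] [Module F V] {d : ℕ}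

theorem IsLeonard.downArrow {Φ : TridiagonalSystem F V d} (h : Φ.IsLeonard) :
    Φ.downArrow.IsLeonard := fun i => ⟨(h i.rev).1, (h i).2⟩

theorem IsLeonard.exists_split {Φ : TridiagonalSystem F V d} (hΦ : Φ.IsLeonard) :
    ∃ (θ θs φ : ℕ → F) (e f : ℕ → V →ₗ[F] F) (u : V),
      EigenCoords Φ.A Φ.As d θ e ∧ EigenCoords Φ.As Φ.A d θs f ∧
      (∀ i, Φ.theta i = θ i) ∧ (∀ i, Φ.thetaStar i = θs i) ∧
      u ≠ 0 ∧ LinearMap.range (Φ.Es 0) = Submodule.span F {u} ∧ Φ.As u = θs 0 • u ∧ e d u ≠ 0 ∧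
      (∀ i < d, Φ.As (splitVec Φ.A θ u (i + 1)) =
        θs (i + 1) • splitVec Φ.A θ u (i + 1) + φ (i + 1) • splitVec Φ.A θ u i) ∧
      ∀ k : Fin d, Φ.firstSplit k = φ (k + 1) := by
  obtain ⟨θ, e, hE, hθ, hEm⟩ :=
    Φ.standard.exists_eigenCoords Φ.pair.diagonalizable fun i => (hΦ i).1
  obtain ⟨θs, f, hS, hθs, hSm⟩ :=
    Φ.standard_dual.exists_eigenCoords Φ.pair.diagonalizable_dual fun i => (hΦ i).2
  obtain ⟨u, hu0, hu⟩ := hS.exists_dual 0 (Nat.zero_le d)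
  have hu' : ∀ j, 0 < j → f j u = 0 := fun j hj => hu j (by omega)
  have hu0' : f 0 u ≠ 0 := by rw [hu0]; exact one_ne_zero
  have hc : ∀ i, ∃ c : F, i < d → Φ.As (splitVec Φ.A θ u (i + 1)) =
      θs (i + 1) • splitVec Φ.A θ u (i + 1) + c • splitVec Φ.A θ u i := fun i => by
    by_cases hi : i < d
    · obtain ⟨c, hc⟩ := hE.exists_split_scalar hS Φ.pair hu' hu0' hi
      exact ⟨c, fun _ => hc⟩
    · exact ⟨0, fun h => absurd h hi⟩
  choose c hc using hc
  -- The shift matches the numbering φ_1, …, φ_d; the value at `0` plays no role.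
  refine ⟨θ, θs, fun i => c (i - 1), e, f, u, hE, hS, hθ, hθs, fun h => hu0' (by rw [h, map_zero]), ?_, ?_,
    hE.last_coord_ne_zero hS Φ.pair hu' hu0', fun i hi => hc i hi, fun k => ?_⟩
  · have hm : ∀ w, w ∈ LinearMap.range (Φ.Es 0) ↔ ∀ j : Fin (d + 1), ¬ j = 0 → f j w = 0 := by
      intro w
      rw [← hSm (fun j => j = 0)]
      simp only [iSup_iSup_eq_left]
    ext w
    rw [hm, Submodule.mem_span_singleton]
    constructor
    · intro h
      refine ⟨f 0 w, (sub_eq_zero.1 (hS.ext _ fun j hj => ?_)).symm⟩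
      rw [map_sub, map_smul, smul_eq_mul]
      by_cases hj0 : j = 0
      · rw [hj0, hu0]; ring
      · rw [hu j hj0, mul_zero, sub_zero]
        exact h ⟨j, by omega⟩ (by simpa [Fin.ext_iff] using hj0)
    · rintro ⟨a, rfl⟩ j hj
      rw [map_smul, hu j fun h => hj (Fin.ext h), smul_zero]
  · refine sub_eq_zero.1 (hS.ext _ fun j _ => ?_)
    rw [map_sub, map_smul, hS.eig, smul_eq_mul]
    by_cases hj0 : j = 0
    · rw [hj0]; ring
    · rw [hu j hj0]; ring
  · have hk := k.2
    have hmem : ∀ w, w ∈ Φ.splitSpace k.succ ↔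
        (∀ j, (k : ℕ) + 1 < j → f j w = 0) ∧ ∀ j, j < (k : ℕ) + 1 → e j w = 0 := by
      intro w
      rw [splitSpace, Submodule.mem_inf, hSm, hEm]
      constructor
      · rintro ⟨h1, h2⟩
        refine ⟨fun j hj => ?_, fun j hj => ?_⟩
        · by_cases hjd : j < d + 1
          · exact h1 ⟨j, hjd⟩ (by simpa [Fin.le_def] using hj)
          · rw [hS.zero j (by omega)]; rfl
        · exact h2 ⟨j, by omega⟩ (by simpa [Fin.le_def] using hj)
      · rintro ⟨h1, h2⟩
        exact ⟨fun j hj => h1 j (by simpa [Fin.le_def] using hj),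
          fun j hj => h2 j (by simpa [Fin.le_def] using hj)⟩
    have hne : splitVec Φ.A θ u ((k : ℕ) + 1) ≠ 0 := fun h =>
      hS.splitVec_coord_ne_zero (θ := θ) Φ.pair hu' hu0' (i := k + 1) (by omega)
        (by rw [h, map_zero])
    refine eigenvalueOn_eq (fun w hw => ?_) ((hmem _).2
      ⟨hS.lower_splitVec hu' _, fun j hj => hE.upper_splitVec hj⟩) hne
    obtain ⟨h1, h2⟩ := (hmem w).1 hw
    obtain ⟨a, rfl⟩ := hE.eq_smul_splitVec hS Φ.pair hu' hu0' (i := k + 1) (by omega) h1 h2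
    rw [map_smul, smul_comm]
    congr 1
    have hθk : Φ.theta k.castSucc = θ k := hθ _
    have hθsk : Φ.thetaStar k.succ = θs (k + 1) := hθs _
    have key : (Φ.As - algebraMap F (Module.End F V) (Φ.thetaStar k.succ))
        (splitVec Φ.A θ u ((k : ℕ) + 1)) = c k • splitVec Φ.A θ u k := by
      rw [LinearMap.sub_apply, Module.algebraMap_end_apply, hc k hk, hθsk, add_sub_cancel_left]
    rw [Module.End.mul_apply, key, map_smul, LinearMap.sub_apply, Module.algebraMap_end_apply, hθk]
    rfl

/-- Reads φ_1 on E*_0 V instead of U_1. That line is shared with the system having reversed E_i, so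
the two split sequences can be compared there. -/
theorem IsLeonard.apply_firstSplit_zero {Φ : TridiagonalSystem F V d} (hΦ : Φ.IsLeonard)
    (hd : 0 < d) {w : V} (hw : w ∈ LinearMap.range (Φ.Es 0)) :
    Φ.As w = Φ.thetaStar 0 • w ∧
    Φ.As (Φ.A w - Φ.theta 0 • w) - Φ.thetaStar ⟨1, by omega⟩ • (Φ.A w - Φ.theta 0 • w) =
      Φ.firstSplit ⟨0, hd⟩ • w := by
  obtain ⟨θ, θs, φ, e, f, u, hE, hS, hθ, hθs, hu0, hu, hus, -, hφ, hk⟩ := hΦ.exists_split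
  rw [hu] at hw
  obtain ⟨a, rfl⟩ := Submodule.mem_span_singleton.1 hw
  have h := hφ 0 hd
  rw [hθ, hθs, hθs, hk]
  simp only [splitVec, zero_add, Fin.val_zero] at h ⊢
  refine ⟨by rw [map_smul, hus, smul_comm], ?_⟩
  have e1 : Φ.A (a • u) - θ 0 • a • u = a • (Φ.A u - θ 0 • u) := by
    rw [map_smul]; module
  rw [e1, map_smul, h]
  module

/-- On E*_0 V the two scalars are those of (A* - θ*_1)(A - θ_0) and (A* - θ*_1)(A - θ_d). The
operators differ by a multiple of A* - θ*_1, which acts there as θ*_0 - θ*_1. -/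
theorem IsLeonard.firstSplit_sub_secondSplit {Φ : TridiagonalSystem F V d} (hΦ : Φ.IsLeonard)
    (hd : 0 < d) : Φ.firstSplit ⟨0, hd⟩ - Φ.secondSplit ⟨0, hd⟩ =
      (Φ.theta (Fin.last d) - Φ.theta 0) * (Φ.thetaStar 0 - Φ.thetaStar ⟨1, by omega⟩) := by
  obtain ⟨w, hw, hw0⟩ : ∃ w ∈ LinearMap.range (Φ.Es 0), w ≠ 0 := by
    obtain ⟨θ, θs, φ, e, f, u, -, -, -, -, hu0, hu, -⟩ := hΦ.exists_split
    exact ⟨u, hu ▸ Submodule.mem_span_singleton_self u, hu0⟩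
  obtain ⟨h0, h1⟩ := hΦ.apply_firstSplit_zero hd hw
  obtain ⟨-, h2⟩ := hΦ.downArrow.apply_firstSplit_zero hd (w := w) hw
  have e1 : Φ.downArrow.theta 0 = Φ.theta (Fin.last d) := by
    simp [theta, TridiagonalSystem.downArrow]
  change Φ.As (Φ.A w - Φ.downArrow.theta 0 • w) - Φ.thetaStar ⟨1, by omega⟩ •
    (Φ.A w - Φ.downArrow.theta 0 • w) = Φ.secondSplit ⟨0, hd⟩ • w at h2
  rw [e1] at h2
  apply smul_left_injective F hw0
  simp only [sub_smul, ← h1, ← h2, map_sub, map_smul, h0]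
  module

/-- The factors in A raise u to the i-th split vector, and those in A* bring it back to u, each step
down contributing one φ. Here `φ k` stands for φ_{k+1}. -/
theorem IsLeonard.splitSeq_eq {Φ : TridiagonalSystem F V d} (hΦ : Φ.IsLeonard)
    {φ : ℕ → F} (hφ : ∀ k : Fin d, Φ.firstSplit k = φ k) (i : Fin (d + 1)) :
    Φ.splitSeq i = ∏ k ∈ Finset.range i, φ k := by
  obtain ⟨θ, θs, φ', e, f, u, hE, hS, hθ, hθs, hu0, hu, hus, -, hφ', hk⟩ := hΦ.exists_split
  have hφφ : ∀ k < d, φ' (k + 1) = φ k := fun k hk' => by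
    rw [← hφ ⟨k, hk'⟩, hk]
  have hprod : ∀ (p : ℕ → Prop) [DecidablePred p] (g : Fin (d + 1) → F) (g' : ℕ → F),
      (∀ h, g h = g' h) → ∏ h ∈ Finset.univ.filter (fun h : Fin (d + 1) => p (h : ℕ)), (X - C (g h)) =
        ∏ h ∈ (Finset.range (d + 1)).filter p, (X - C (g' h)) := by
    intro p _ g g' hg
    rw [Finset.prod_filter, Finset.prod_filter,
      ← Fin.prod_univ_eq_prod_range (fun h => if p h then X - C (g' h) else 1)]
    simp only [hg]
  have hA : ∀ n, aeval Φ.A (∏ h ∈ Finset.range n, (X - C (θ h))) u = splitVec Φ.A θ u n := by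
    intro n
    induction n with
    | zero => simp [splitVec]
    | succ n ih =>
      rw [Finset.prod_range_succ, mul_comm, map_mul, Module.End.mul_apply, ih]
      simp [splitVec]
  have hB : ∀ n ≤ d, aeval Φ.As (∏ h ∈ Finset.range n, (X - C (θs (h + 1)))) (splitVec Φ.A θ u n) =
      (∏ k ∈ Finset.range n, φ k) • u := by
    intro n hn
    induction n with
    | zero => simp [splitVec]
    | succ n ih =>
      rw [Finset.prod_range_succ, map_mul, Module.End.mul_apply]
      have : aeval Φ.As (X - C (θs (n + 1))) (splitVec Φ.A θ u (n + 1)) =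
          φ n • splitVec Φ.A θ u n := by
        simp [hφ' n (by omega), hφφ n (by omega)]
      rw [this, map_smul, ih (by omega), smul_smul, Finset.prod_range_succ, mul_comm]
  have hi := i.2
  have h1 : ∏ h : Fin (d + 1) with h < i, (X - C (Φ.theta h)) =
      ∏ h ∈ Finset.range i, (X - C (θ h)) := by
    have : (Finset.range (d + 1)).filter (fun h => h < (i : ℕ)) = Finset.range i := by
      ext h; simp; omega
    rw [← this]
    exact hprod (fun h => h < (i : ℕ)) _ _ hθ
  have h2 : ∏ h : Fin (d + 1) with 0 < h ∧ h ≤ i, (X - C (Φ.thetaStar h)) =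
      ∏ h ∈ Finset.range i, (X - C (θs (h + 1))) := by
    have : (Finset.range (d + 1)).filter (fun h => 0 < h ∧ h ≤ (i : ℕ)) =
        (Finset.range i).image (· + 1) := by
      ext h
      simp only [Finset.mem_filter, Finset.mem_range, Finset.mem_image]
      constructor
      · rintro ⟨_, h1, h2⟩
        exact ⟨h - 1, by omega, by omega⟩
      · rintro ⟨k, hk, rfl⟩
        omega
    rw [← Finset.prod_image (f := fun h => X - C (θs h)) (g := (· + 1)) (by simp), ← this]
    exact hprod (fun h => 0 < h ∧ h ≤ (i : ℕ)) _ _ hθs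
  refine eigenvalueOn_eq (w := u) (fun w hw => ?_) (hu ▸ Submodule.mem_span_singleton_self u) hu0
  rw [hu] at hw
  obtain ⟨a, rfl⟩ := Submodule.mem_span_singleton.1 hw
  rw [h1, h2, map_smul, Module.End.mul_apply, hA, hB _ (by omega), smul_comm]

end TridiagonalSystem

/-! ### Algebra of the type I parametrization -/

/-- A singular 2 × 2 matrix is a column times a row. -/
theorem exists_mul_eq_of_mul_eq_mul {K : Type*} [Field K] {ψ ψ' x y : K} (h : ψ * ψ' = x * y) :
    ∃ α β γ δ : K, ψ = α * γ ∧ ψ' = β * δ ∧ x = α * δ ∧ y = β * γ := by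
  by_cases hψ : ψ = 0
  · rw [hψ, zero_mul, eq_comm, mul_eq_zero] at h
    rcases h with h | h
    · exact ⟨0, 1, y, ψ', by simp [hψ], by simp, by simp [h], by simp⟩
    · exact ⟨x, ψ', 0, 1, by simp [hψ], by simp, by simp, by simp [h]⟩
  · exact ⟨1, y / ψ, ψ, x, by simp, by field_simp; linear_combination h, by simp,
      by field_simp⟩

/-- The scalars satisfying the last-row equations have the type I form. -/
theorem exists_typeI_split {K : Type*} [Field K] {q a b c as bs cs x : K} (hq : q ≠ 0) {d : ℕ}
    {θ θs φ : ℕ → K} (hd : 0 < d)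
    (hθ : ∀ i : ℕ, i ≤ d → θ i = a + b * q ^ (2 * (i : ℤ) - d) + c * q ^ ((d : ℤ) - 2 * i))
    (hθs : ∀ i : ℕ, i ≤ d → θs i = as + bs * q ^ (2 * (i : ℤ) - d) + cs * q ^ ((d : ℤ) - 2 * i))
    (hne : ∀ i < d, θ d ≠ θ i)
    (hx : ∀ i < d, φ (i + 1) * ∏ h ∈ Finset.range i, (θ d - θ h) =
      (x - θs (i + 1)) * ∏ h ∈ Finset.range (i + 1), (θ d - θ h) +
        (θs 0 - x) * ∏ h ∈ Finset.range (i + 1), (θ (d - 1) - θ h)) :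
    ∃ t : K, ∀ i : ℕ, i < d → φ (i + 1) =
      (q ^ ((i : ℤ) + 1) - q ^ (-((i : ℤ) + 1))) * (q ^ ((d : ℤ) - i) - q ^ ((i : ℤ) - d)) *
        (t - b * bs * q ^ (2 * (i : ℤ) + 1 - d) - c * cs * q ^ ((d : ℤ) - 1 - 2 * i)) := by
  have sq : ∀ x : K, x ^ (2 : ℤ) = x ^ 2 := fun x => by norm_cast
  have h1 : ∀ h ≤ d, θ d - θ h =
      (q ^ ((d : ℤ) - h) - q ^ ((h : ℤ) - d)) * (b * q ^ (h : ℤ) - c * q ^ (-(h : ℤ))) := by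
    intro h hh
    rw [hθ d le_rfl, hθ h hh]
    have hm : q ^ (h : ℤ) ≠ 0 := zpow_ne_zero _ hq
    have hn : q ^ (d : ℤ) ≠ 0 := zpow_ne_zero _ hq
    simp only [zpow_sub₀ hq, zpow_neg, mul_comm (2 : ℤ), zpow_mul, sq]
    generalize q ^ (h : ℤ) = M at *
    generalize q ^ (d : ℤ) = N at *
    field_simp
    ring
  have h2 : ∀ h ≤ d, θ (d - 1) - θ h = (q ^ ((d : ℤ) - h - 1) - q ^ ((h : ℤ) - d + 1)) *
      (b * q ^ ((h : ℤ) - 1) - c * q ^ (1 - (h : ℤ))) := by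
    intro h hh
    rw [hθ (d - 1) (by omega), hθ h hh, Nat.cast_sub hd]
    have hm : q ^ (h : ℤ) ≠ 0 := zpow_ne_zero _ hq
    have hn : q ^ (d : ℤ) ≠ 0 := zpow_ne_zero _ hq
    simp only [zpow_sub₀ hq, zpow_add₀ hq, mul_comm (2 : ℤ), zpow_mul, sq, zpow_one,
      Nat.cast_one]
    generalize q ^ (h : ℤ) = M at *
    generalize q ^ (d : ℤ) = N at *
    field_simp
    ring
  have hbr : q ^ (d : ℤ) - q ^ (-(d : ℤ)) ≠ 0 := by
    intro h0
    have := h1 0 (Nat.zero_le d)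
    rw [Nat.cast_zero, sub_zero, zero_sub, h0, zero_mul] at this
    exact hne 0 hd (sub_eq_zero.1 this)
  -- The quotient of the two products telescopes: θ_{d-1} - θ_{h+1} and θ_d - θ_h share the factor
  -- bq^h - cq^{-h}.
  have h3 : ∀ i < d, (q ^ (d : ℤ) - q ^ (-(d : ℤ))) *
      ∏ h ∈ Finset.range (i + 1), (θ (d - 1) - θ h) =
      (q ^ ((d : ℤ) - i) - q ^ ((i : ℤ) - d)) * (q ^ ((d : ℤ) - i - 1) - q ^ ((i : ℤ) - d + 1)) *
        (b * q ^ (-1 : ℤ) - c * q) * ∏ h ∈ Finset.range i, (θ d - θ h) := by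
    intro i hi
    induction i with
    | zero => simp [h2, mul_assoc]
    | succ i ih =>
      rw [Finset.prod_range_succ, ← mul_assoc, ih (by omega), Finset.prod_range_succ,
        h1 i (by omega), h2 (i + 1) (by omega)]
      push_cast
      have x1 : (d : ℤ) - (i + 1) = d - i - 1 := by ring
      have x2 : (i : ℤ) + 1 - d = i - d + 1 := by ring
      have x3 : (i : ℤ) + 1 - 1 = i := by ring
      have x4 : 1 - ((i : ℤ) + 1) = -i := by ring
      rw [x1, x2, x3, x4]
      ring
  -- This t is read off from the equation for φ_d, where the second product contains θ_{d-1} -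
  -- θ_{d-1} and drops out.
  refine ⟨(x - θs 0) * (b * q ^ ((d : ℤ) - 1) - c * q ^ (1 - (d : ℤ))) /
    (q ^ (d : ℤ) - q ^ (-(d : ℤ))) + b * cs * q ^ ((d : ℤ) - 1) + c * bs * q ^ (1 - (d : ℤ)),
    fun i hi => ?_⟩
  have hT : ∏ h ∈ Finset.range i, (θ d - θ h) ≠ 0 :=
    Finset.prod_ne_zero_iff.2 fun h hh => sub_ne_zero.2 (hne h (by
      have := Finset.mem_range.1 hh; omega))
  apply mul_right_cancel₀ hT
  apply mul_left_cancel₀ hbr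
  have hxi := hx i hi
  have h3i := h3 i hi
  rw [Finset.prod_range_succ (fun h => θ d - θ h), h1 i hi.le] at hxi
  have e1 : θs (i + 1) = θs 0 + (q ^ ((i : ℤ) + 1) - q ^ (-((i : ℤ) + 1))) *
      (bs * q ^ ((i : ℤ) + 1 - d) - cs * q ^ ((d : ℤ) - 1 - i)) := by
    rw [hθs 0 (Nat.zero_le d), hθs (i + 1) hi]
    have hm : q ^ (i : ℤ) ≠ 0 := zpow_ne_zero _ hq
    have hn : q ^ (d : ℤ) ≠ 0 := zpow_ne_zero _ hq
    push_cast
    simp only [zpow_sub₀ hq, zpow_add₀ hq, zpow_neg, mul_comm (2 : ℤ), zpow_mul, sq, zpow_one,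
      zpow_zero]
    generalize q ^ (i : ℤ) = M at *
    generalize q ^ (d : ℤ) = N at *
    field_simp
    ring
  rw [e1] at hxi
  generalize ∏ h ∈ Finset.range i, (θ d - θ h) = T at *
  generalize ∏ h ∈ Finset.range (i + 1), (θ (d - 1) - θ h) = S at *
  have key : (q ^ (d : ℤ) - q ^ (-(d : ℤ))) * (φ (i + 1) * T) =
      (q ^ ((d : ℤ) - i) - q ^ ((i : ℤ) - d)) * T * ((q ^ (d : ℤ) - q ^ (-(d : ℤ))) *
        (x - (θs 0 + (q ^ ((i : ℤ) + 1) - q ^ (-((i : ℤ) + 1))) *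
          (bs * q ^ ((i : ℤ) + 1 - d) - cs * q ^ ((d : ℤ) - 1 - i)))) *
          (b * q ^ (i : ℤ) - c * q ^ (-(i : ℤ))) +
        (θs 0 - x) * (q ^ ((d : ℤ) - i - 1) - q ^ ((i : ℤ) - d + 1)) *
          (b * q ^ (-1 : ℤ) - c * q)) := by
    linear_combination (q ^ (d : ℤ) - q ^ (-(d : ℤ))) * hxi + (θs 0 - x) * h3i
  rw [key]
  have e2 : ∀ D P Q R : K, (q ^ (d : ℤ) - q ^ (-(d : ℤ))) * (P * Q *
      (D / (q ^ (d : ℤ) - q ^ (-(d : ℤ))) + R) * T) = Q * T * (P * (D +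
        (q ^ (d : ℤ) - q ^ (-(d : ℤ))) * R)) := by
    intro D P Q R
    field_simp
  simp only [add_assoc, add_sub_assoc]
  rw [e2]
  congr 1
  have hm : q ^ (i : ℤ) ≠ 0 := zpow_ne_zero _ hq
  have hn : q ^ (d : ℤ) ≠ 0 := zpow_ne_zero _ hq
  simp only [zpow_sub₀ hq, zpow_add₀ hq, zpow_neg, mul_comm (2 : ℤ), zpow_mul, sq, zpow_one]
  clear e2 key hxi h3i hbr h1 h2 h3 hx hθ hθs hne
  generalize q ^ (i : ℤ) = M at *
  generalize q ^ (d : ℤ) = N at *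
  field_simp
  ring

theorem Finset.prod_Icc_succ_eq_prod_range {M : Type*} [CommMonoid M] (f : ℕ → M) (m d : ℕ) :
    ∏ j ∈ Finset.Icc (m + 1) d, f j = ∏ j ∈ Finset.range (d - m), f (m + 1 + j) := by
  rw [← Finset.Ico_add_one_right_eq_Icc, Finset.prod_Ico_eq_prod_range, Nat.add_sub_add_right]

/-- With [k] = q^k - q^{-k}, both sides are [d]!^3 / ([m]! [d-m]!). The induction on m avoids this
division. -/
theorem prod_qNumber_eq {K : Type*} [Field K] {q : K} (hq : q ≠ 0) {d : ℕ}
    (hbr : ∀ j : ℕ, 0 < j → j ≤ d → q ^ (j : ℤ) - q ^ (-(j : ℤ)) ≠ 0) {m : ℕ} (hm : m ≤ d) :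
    (∏ k ∈ Finset.range (d - m), (q ^ ((k : ℤ) + 1) - q ^ (-((k : ℤ) + 1))) *
        (q ^ ((d : ℤ) - k) - q ^ ((k : ℤ) - d))) *
      ∏ k ∈ Finset.range m, (q ^ ((d : ℤ) - k) - q ^ ((k : ℤ) - d)) ^ 2 =
    symmQBinom q d m * ∏ k ∈ Finset.range d, (q ^ ((k : ℤ) + 1) - q ^ (-((k : ℤ) + 1))) ^ 2 := by
  induction m with
  | zero =>
    rw [Nat.sub_zero, Finset.prod_range_zero, mul_one, symmQBinom_zero_right, one_mul,
      Finset.prod_mul_distrib, Finset.prod_pow, pow_two]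
    congr 1
    rw [← Finset.prod_range_reflect (fun k : ℕ => q ^ ((d : ℤ) - k) - q ^ ((k : ℤ) - d))]
    refine Finset.prod_congr rfl fun k hk => ?_
    have hk' := Finset.mem_range.1 hk
    have : ((d - 1 - k : ℕ) : ℤ) = d - 1 - k := by omega
    rw [this]
    congr 2 <;> ring
  | succ m ih =>
    have h := ih (by omega)
    have hs : d - m = d - (m + 1) + 1 := by omega
    have hc : ((d - (m + 1) : ℕ) : ℤ) = d - m - 1 := by omega
    rw [hs, Finset.prod_range_succ, hc] at h
    rw [Finset.prod_range_succ _ m]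
    have hb := hbr (m + 1) (by omega) hm
    push_cast at hb
    have hB := symmQBinom_mul_succ hq d m
    apply mul_left_cancel₀ hb
    have x1 : (d : ℤ) - m - 1 + 1 = d - m := by ring
    have x2 : -((d : ℤ) - m) = m - d := by ring
    have x3 : (d : ℤ) - (d - m - 1) = m + 1 := by ring
    have x4 : (d : ℤ) - m - 1 - d = -(m + 1) := by ring
    rw [x1, x2, x3, x4] at h
    linear_combination (q ^ ((d : ℤ) - m) - q ^ ((m : ℤ) - d)) * h -
      (∏ k ∈ Finset.range d, (q ^ ((k : ℤ) + 1) - q ^ (-((k : ℤ) + 1))) ^ 2) * hB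

/-! ### Type I Leonard systems and the Drinfel'd polynomial -/

namespace TridiagonalSystem

variable {F V : Type*} [Field F] [AddCommGroup V] [Module F V] {d : ℕ}

theorem IsTypeIParam.downArrow {Φ : TridiagonalSystem F V d} {β : F}
    {q a b c as bs cs : AlgebraicClosure F} (h : Φ.IsTypeIParam β q a b c as bs cs) :
    Φ.downArrow.IsTypeIParam β q a c b as bs cs := by
  refine ⟨h.1, h.2.1, fun i => ⟨?_, (h.2.2 i).2⟩⟩
  have := (h.2.2 i.rev).1
  have hi : ((i.rev : ℕ) : ℤ) = d - i := by
    have := i.2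
    rw [Fin.val_rev]; omega
  rw [hi] at this
  have x1 : 2 * ((d : ℤ) - i) - d = d - 2 * i := by ring
  have x2 : (d : ℤ) - 2 * (d - i) = 2 * i - d := by ring
  rw [x1, x2] at this
  exact this.trans (by ring)

theorem IsLeonard.theta_injective {Φ : TridiagonalSystem F V d} (hΦ : Φ.IsLeonard) :
    Function.Injective Φ.theta := by
  obtain ⟨θ, θs, φ, e, f, u, hE, -, hθ, -⟩ := hΦ.exists_split
  intro i j hij
  rw [hθ, hθ] at hij
  exact Fin.ext (hE.inj _ _ (by omega) (by omega) hij)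

/-- θ_j - θ_0 is a multiple of q^j - q^{-j}, and the eigenvalues are distinct. -/
theorem IsTypeIParam.qNumber_ne_zero {Φ : TridiagonalSystem F V d} (hΦ : Φ.IsLeonard) {β : F}
    {q a b c as bs cs : AlgebraicClosure F} (h : Φ.IsTypeIParam β q a b c as bs cs) {j : ℕ}
    (hj : 0 < j) (hjd : j ≤ d) : q ^ (j : ℤ) - q ^ (-(j : ℤ)) ≠ 0 := by
  intro h0
  have hq := h.1
  have h1 := (h.2.2 0).1
  have h2 := (h.2.2 ⟨j, by omega⟩).1
  have : algebraMap F (AlgebraicClosure F) (Φ.theta ⟨j, by omega⟩) =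
      algebraMap F (AlgebraicClosure F) (Φ.theta 0) := by
    rw [h1, h2]
    have hm : q ^ (j : ℤ) ≠ 0 := zpow_ne_zero _ hq
    have hn : q ^ (d : ℤ) ≠ 0 := zpow_ne_zero _ hq
    have sq : ∀ x : AlgebraicClosure F, x ^ (2 : ℤ) = x ^ 2 := fun x => by norm_cast
    simp only [zpow_sub₀ hq, zpow_neg, mul_comm (2 : ℤ), zpow_mul, sq, Fin.val_zero,
      Nat.cast_zero, zero_mul, zpow_zero] at h0 ⊢
    generalize q ^ (j : ℤ) = M at *
    generalize q ^ (d : ℤ) = N at *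
    field_simp at h0 ⊢
    linear_combination (b * M ^ 2 - c * N ^ 2) * h0
  have := congrArg Fin.val (hΦ.theta_injective ((algebraMap F _).injective this))
  simp at this
  omega

theorem IsLeonard.exists_firstSplit {Φ : TridiagonalSystem F V d} (hΦ : Φ.IsLeonard) {β : F}
    {q a b c as bs cs : AlgebraicClosure F} (h : Φ.IsTypeIParam β q a b c as bs cs) (hd : 0 < d) :
    ∃ t : AlgebraicClosure F, ∀ k : Fin d, algebraMap F (AlgebraicClosure F) (Φ.firstSplit k) =
      (q ^ ((k : ℤ) + 1) - q ^ (-((k : ℤ) + 1))) * (q ^ ((d : ℤ) - k) - q ^ ((k : ℤ) - d)) *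
        (t - b * bs * q ^ (2 * (k : ℤ) + 1 - d) - c * cs * q ^ ((d : ℤ) - 1 - 2 * k)) := by
  obtain ⟨θ, θs, φ, e, f, u, hE, hS, hθ, hθs, hu0, hu, hus, heu, hφ, hk⟩ := hΦ.exists_split
  obtain ⟨x, hx⟩ := hE.exists_split_formula hus heu hφ
  obtain ⟨t, ht⟩ := exists_typeI_split (a := a) (b := b) (c := c) (as := as) (bs := bs) (cs := cs)
    (x := algebraMap F (AlgebraicClosure F) x)
    (θ := fun i => algebraMap F (AlgebraicClosure F) (θ i))
    (θs := fun i => algebraMap F (AlgebraicClosure F) (θs i))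
    (φ := fun i => algebraMap F (AlgebraicClosure F) (φ i)) h.1 hd
    (fun i hi => by rw [← (h.2.2 ⟨i, by omega⟩).1, hθ])
    (fun i hi => by rw [← (h.2.2 ⟨i, by omega⟩).2, hθs])
    (fun i hi heq => by
      have := hE.inj _ _ le_rfl hi.le ((algebraMap F _).injective heq)
      omega)
    (fun i hi => by
      have := congrArg (algebraMap F (AlgebraicClosure F)) (hx i hi)
      simpa only [map_mul, map_add, map_sub, map_prod] using this)
  exact ⟨t, fun k => by rw [hk]; exact ht k k.2⟩

theorem IsLeonard.exists_isSplitParam {Φ : TridiagonalSystem F V d} (hΦ : Φ.IsLeonard) {β : F}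
    {q a b c as bs cs : AlgebraicClosure F} (h : Φ.IsTypeIParam β q a b c as bs cs) :
    ∃ t : AlgebraicClosure F, Φ.IsSplitParam q b c bs cs t := by
  rcases Nat.eq_zero_or_pos d with rfl | hd
  · exact ⟨0, fun k => k.elim0⟩
  obtain ⟨t, ht⟩ := hΦ.exists_firstSplit h hd
  obtain ⟨t', ht'⟩ := hΦ.downArrow.exists_firstSplit h.downArrow hd
  change ∀ k : Fin d, algebraMap F (AlgebraicClosure F) (Φ.secondSplit k) = _ at ht'
  -- In φ_1 minus its counterpart, t - t' has coefficient (q - q^{-1})(q^d - q^{-d}), which is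
  -- nonzero.
  have htt : t = t' := by
    have h0 := congrArg (algebraMap F (AlgebraicClosure F)) (hΦ.firstSplit_sub_secondSplit hd)
    rw [map_sub, ht, ht', map_mul, map_sub, map_sub, (h.2.2 _).1, (h.2.2 _).1, (h.2.2 _).2,
      (h.2.2 _).2] at h0
    have hq := h.1
    have hbr1 := h.qNumber_ne_zero hΦ Nat.one_pos hd
    have hbrd := h.qNumber_ne_zero hΦ hd le_rfl
    have hn : q ^ (d : ℤ) ≠ 0 := zpow_ne_zero _ hq
    have sq : ∀ x : AlgebraicClosure F, x ^ (2 : ℤ) = x ^ 2 := fun x => by norm_cast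
    apply mul_left_cancel₀ (mul_ne_zero hbr1 hbrd)
    simp only [zpow_sub₀ hq, zpow_add₀ hq, zpow_neg, mul_comm (2 : ℤ), zpow_mul, sq, zpow_one,
      zpow_zero, zero_mul, Nat.cast_zero, Nat.cast_one, Fin.val_zero, Fin.val_last] at h0 ⊢
    clear ht ht' hbr1 hbrd
    generalize q ^ (d : ℤ) = N at *
    field_simp at h0 ⊢
    apply mul_left_cancel₀ (mul_ne_zero hq hn)
    linear_combination h0
  refine ⟨t, ?_⟩
  rintro k _ rfl
  have x1 : (d : ℤ) - (k + 1) + 1 = d - k := by ring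
  have x2 : (k : ℤ) + 1 - d - 1 = k - d := by ring
  have x3 : 2 * ((k : ℤ) + 1) - d - 1 = 2 * k + 1 - d := by ring
  have x4 : (d : ℤ) + 1 - 2 * (k + 1) = d - 1 - 2 * k := by ring
  rw [x1, x2, x3, x4]
  exact ⟨ht k, htt ▸ ht' k⟩

theorem IsSplitParam.normalizedDrinfeld_eq {Φ : TridiagonalSystem F V d} (hΦ : Φ.IsLeonard) {β : F}
    {q a b c as bs cs t : AlgebraicClosure F} (h : Φ.IsTypeIParam β q a b c as bs cs)
    (ht : Φ.IsSplitParam q b c bs cs t) {ψ ψ' : AlgebraicClosure F} (hadd : ψ + ψ' = t)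
    (hmul : ψ * ψ' = b * bs * (c * cs)) :
    ∃ κ : AlgebraicClosure F, κ ≠ 0 ∧ Φ.normalizedDrinfeld q b c bs cs =
      C κ * ∏ i ∈ Finset.Icc 1 d, (X - C (ψ * q ^ ((d : ℤ) + 1 - 2 * (i : ℤ)) +
        ψ' * q ^ (2 * (i : ℤ) - (d : ℤ) - 1))) := by
  have hq := h.1
  obtain ⟨α, β', γ, δ, e1, e2, e3, e4⟩ := exists_mul_eq_of_mul_eq_mul hmul
  have hbr : ∀ j : ℕ, 0 < j → j ≤ d → q ^ (j : ℤ) - q ^ (-(j : ℤ)) ≠ 0 :=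
    fun j hj hjd => h.qNumber_ne_zero hΦ hj hjd
  -- The constant common to all terms in `prod_qNumber_eq`; the sign comes from writing each factor
  -- as root minus λ.
  refine ⟨(∏ k ∈ Finset.range d, (q ^ ((k : ℤ) + 1) - q ^ (-((k : ℤ) + 1))) ^ 2) * (-1) ^ d,
    ?_, ?_⟩
  · refine mul_ne_zero (Finset.prod_ne_zero_iff.2 fun k hk => pow_ne_zero _ ?_)
      (pow_ne_zero _ (neg_ne_zero.2 one_ne_zero))
    have := hbr (k + 1) (by omega) (by have := Finset.mem_range.1 hk; omega)
    exact_mod_cast this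
  refine Polynomial.funext fun l => ?_
  have hR : (∏ i ∈ Finset.Icc 1 d, (l - (ψ * q ^ ((d : ℤ) + 1 - 2 * (i : ℤ)) +
      ψ' * q ^ (2 * (i : ℤ) - (d : ℤ) - 1)))) * (-1) ^ d = ∏ j ∈ Finset.range d,
      (α * γ * q ^ ((d : ℤ) - 1 - 2 * j) + β' * δ * q ^ (2 * (j : ℤ) + 1 - d) - l) := by
    rw [Finset.prod_Icc_succ_eq_prod_range _ 0 d, Nat.sub_zero, ← Finset.card_range d,
      ← Finset.prod_const, Finset.card_range, ← Finset.prod_mul_distrib]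
    refine Finset.prod_congr rfl fun j _ => ?_
    have x1 : (d : ℤ) + 1 - 2 * (0 + 1 + j : ℕ) = d - 1 - 2 * j := by push_cast; ring
    have x2 : 2 * ((0 + 1 + j : ℕ) : ℤ) - d - 1 = 2 * j + 1 - d := by push_cast; ring
    rw [x1, x2, e1, e2]
    ring
  have hφ : ∀ k : Fin d, Φ.firstSplit k =
      (fun k : ℕ => if hk : k < d then Φ.firstSplit ⟨k, hk⟩ else 0) k := fun k => by simp
  set φ : ℕ → F := fun k => if hk : k < d then Φ.firstSplit ⟨k, hk⟩ else 0
  have hφt : ∀ k < d, algebraMap F (AlgebraicClosure F) (φ k) =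
      (q ^ ((k : ℤ) + 1) - q ^ (-((k : ℤ) + 1))) * (q ^ ((d : ℤ) - k) - q ^ ((k : ℤ) - d)) *
      ((α - β' * q ^ ((d : ℤ) - 1 - 2 * k)) * (γ - δ * q ^ (2 * (k : ℤ) + 1 - d))) := by
    intro k hk
    rw [← hφ ⟨k, hk⟩, (ht ⟨k, hk⟩ _ rfl).1]
    have x1 : (d : ℤ) - (k + 1) + 1 = d - k := by ring
    have x2 : (k : ℤ) + 1 - d - 1 = k - d := by ring
    have x3 : 2 * ((k : ℤ) + 1) - d - 1 = 2 * k + 1 - d := by ring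
    have x4 : (d : ℤ) + 1 - 2 * (k + 1) = d - 1 - 2 * k := by ring
    have x5 : q ^ ((d : ℤ) - 1 - 2 * k) = (q ^ (2 * (k : ℤ) + 1 - d))⁻¹ := by
      rw [← zpow_neg]
      congr 1
      ring
    simp only [x1, x2, x3, x4]
    rw [x5, ← hadd, e1, e2, e3, e4]
    have hz : q ^ (2 * (k : ℤ) + 1 - d) ≠ 0 := zpow_ne_zero _ hq
    generalize q ^ (2 * (k : ℤ) + 1 - d) = Z at *
    congr 1
    field_simp
    ring
  have hL : eval l (Φ.normalizedDrinfeld q b c bs cs) = ∑ i ∈ Finset.range (d + 1),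
      (∏ k ∈ Finset.range i, algebraMap F (AlgebraicClosure F) (φ k)) *
        ∏ j ∈ Finset.Icc (i + 1) d, eval l (pHat d q b c bs cs j) := by
    rw [normalizedDrinfeld, eval_finsetSum, ← Fin.sum_univ_eq_sum_range
      (fun i => (∏ k ∈ Finset.range i, algebraMap F (AlgebraicClosure F) (φ k)) *
        ∏ j ∈ Finset.Icc (i + 1) d, eval l (pHat d q b c bs cs j))]
    refine Finset.sum_congr rfl fun i _ => ?_
    rw [eval_mul, eval_C, eval_prod, hΦ.splitSeq_eq hφ, map_prod]
  rw [hL, eval_mul, eval_C, eval_prod]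
  simp only [eval_sub, eval_X, eval_C]
  -- The sum is reversed because the identity is indexed by the number m = d - i of factors p̂, and
  -- the ζ_i term has d - i of them.
  rw [mul_assoc, mul_comm ((-1 : AlgebraicClosure F) ^ d), hR, ← sum_symmQBinom_mul_prod hq,
    Finset.mul_sum, ← Finset.sum_range_reflect]
  refine Finset.sum_congr rfl fun m hm => ?_
  have hm' : m ≤ d := by have := Finset.mem_range.1 hm; omega
  rw [show d + 1 - 1 - m = d - m by omega, Finset.prod_congr rfl fun k hk => hφt k (by
    have := Finset.mem_range.1 hk; omega), Finset.prod_mul_distrib]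
  have hP : ∏ j ∈ Finset.Icc (d - m + 1) d, eval l (pHat d q b c bs cs j) =
      (∏ k ∈ Finset.range m, (q ^ ((d : ℤ) - k) - q ^ ((k : ℤ) - d)) ^ 2) *
      ∏ k ∈ Finset.range m,
        (α * δ * q ^ (-(2 * (k : ℤ))) + β' * γ * q ^ (2 * (k : ℤ)) - l) := by
    rw [Finset.prod_Icc_succ_eq_prod_range, Nat.sub_sub_self hm', ← Finset.prod_range_reflect,
      ← Finset.prod_mul_distrib]
    refine Finset.prod_congr rfl fun k hk => ?_
    have hk' := Finset.mem_range.1 hk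
    have hi : ((d - m + 1 + (m - 1 - k) : ℕ) : ℤ) = d - k := by omega
    have x1 : -((d : ℤ) - k) = k - d := by ring
    have x2 : 2 * ((d : ℤ) - k) - 2 * d = -(2 * k) := by ring
    have x3 : 2 * (d : ℤ) - 2 * (d - k) = 2 * k := by ring
    rw [pHat, hi, x1, x2, x3, e3, e4]
    simp
  rw [hP]
  linear_combination (∏ k ∈ Finset.range (d - m), (α - β' * q ^ ((d : ℤ) - 1 - 2 * k)) *
    (γ - δ * q ^ (2 * (k : ℤ) + 1 - d))) * (∏ k ∈ Finset.range m,
      (α * δ * q ^ (-(2 * (k : ℤ))) + β' * γ * q ^ (2 * (k : ℤ)) - l)) *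
    prod_qNumber_eq hq hbr hm'

theorem IsSplitParam.normalizedDrinfeld_roots {Φ : TridiagonalSystem F V d} (hΦ : Φ.IsLeonard)
    {β : F} {q a b c as bs cs t : AlgebraicClosure F} (h : Φ.IsTypeIParam β q a b c as bs cs)
    (ht : Φ.IsSplitParam q b c bs cs t) {ψ ψ' : AlgebraicClosure F} (hadd : ψ + ψ' = t)
    (hmul : ψ * ψ' = b * bs * (c * cs)) :
    Φ.normalizedDrinfeld q b c bs cs ≠ 0 ∧ (Φ.normalizedDrinfeld q b c bs cs).roots =
      (Finset.Icc 1 d).val.map (fun i : ℕ => ψ * q ^ ((d : ℤ) + 1 - 2 * (i : ℤ)) +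
        ψ' * q ^ (2 * (i : ℤ) - (d : ℤ) - 1)) := by
  obtain ⟨κ, hκ, hP⟩ := ht.normalizedDrinfeld_eq hΦ h hadd hmul
  rw [hP]
  constructor
  · exact mul_ne_zero (C_ne_zero.2 hκ) (Finset.prod_ne_zero_iff.2 fun i _ => X_sub_C_ne_zero _)
  · have := roots_multiset_prod_X_sub_C ((Finset.Icc 1 d).val.map fun i : ℕ =>
      ψ * q ^ ((d : ℤ) + 1 - 2 * (i : ℤ)) + ψ' * q ^ (2 * (i : ℤ) - (d : ℤ) - 1))
    rw [Multiset.map_map] at this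
    rw [roots_C_mul _ hκ]
    exact this

end TridiagonalSystem

theorem IsAlgClosed.exists_add_eq_and_mul_eq {K : Type*} [Field K] [IsAlgClosed K] (t p : K) :
    ∃ x y : K, x + y = t ∧ x * y = p := by
  obtain ⟨x, hx⟩ := IsAlgClosed.exists_root (X ^ 2 + C (-t) * X + C p : K[X]) (by
    have : (X ^ 2 + C (-t) * X + C p : K[X]) = C 1 * X ^ 2 + C (-t) * X + C p := by simp
    rw [this, degree_quadratic one_ne_zero]
    decide)
  refine ⟨x, t - x, by ring, ?_⟩
  simp only [IsRoot.def, eval_add, eval_mul, eval_pow, eval_X, eval_C] at hx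
  linear_combination -hx

theorem mainTheorem3 {F V : Type*} [Field F] [AddCommGroup V] [Module F V]
    [FiniteDimensional F V] [Nontrivial V] {d : ℕ}
    (Φ : TridiagonalSystem F V d) (hΦ : Φ.IsLeonard)
    (β : F) (hβ : Φ.IsTypeI β)
    (q a b c as bs cs : AlgebraicClosure F) (hq : Φ.IsTypeIParam β q a b c as bs cs) :
    (∃ t : AlgebraicClosure F, Φ.IsSplitParam q b c bs cs t) ∧
    ∀ t : AlgebraicClosure F, Φ.IsSplitParam q b c bs cs t →
      Φ.normalizedDrinfeld q b c bs cs ≠ 0 ∧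
      (b * bs * c * cs ≠ 0 →
        ∀ ψ : AlgebraicClosure F, ψ ≠ 0 → ψ + b * bs * c * cs * ψ⁻¹ = t →
          (Φ.normalizedDrinfeld q b c bs cs).roots =
            (Finset.Icc 1 d).val.map (fun i : ℕ =>
              ψ * q ^ ((d : ℤ) + 1 - 2 * (i : ℤ)) +
                b * bs * c * cs * ψ⁻¹ * q ^ (2 * (i : ℤ) - (d : ℤ) - 1))) ∧
      (b * bs * c * cs = 0 →
        (Φ.normalizedDrinfeld q b c bs cs).roots =
          (Finset.Icc 1 d).val.map (fun i : ℕ =>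
            t * q ^ ((d : ℤ) + 1 - 2 * (i : ℤ)))) := by
  refine ⟨hΦ.exists_isSplitParam hq, fun t ht => ⟨?_, fun _ ψ hψ hψt => ?_, fun h0 => ?_⟩⟩
  · obtain ⟨ψ, ψ', hadd, hmul⟩ := IsAlgClosed.exists_add_eq_and_mul_eq t (b * bs * (c * cs))
    exact (ht.normalizedDrinfeld_roots hΦ hq hadd hmul).1
  · exact (ht.normalizedDrinfeld_roots hΦ hq hψt (by field_simp)).2
  · have := (ht.normalizedDrinfeld_roots hΦ hq (add_zero t)
      (by rw [mul_zero]; linear_combination -h0)).2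
    simpa only [zero_mul, add_zero] using this
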